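/- **Conventions.** Ideals in $C^*$-algebras are closed and two-sided; $I^\perp=\{a: aI=0\}$. For a $C^*$-algebra $A$, a map $T:A\to B$ is *extendible* if it extends to a (necessarily unique) strictly continuous map $\overline T:M(A)\to M(B)$ of multiplier algebras. A *$C^*$-dynamical system* $(A,\alpha)$ is a $C^*$-algebra $A$ with an extendible endomorphism $\alpha$. A *complete transfer operator* for it is a positive linear map $\alpha_*:A\to A$ with $\alpha_*(\alpha(a)b)=a\alpha_*(b)$ and $\alpha(\alpha_*(a))=\overline\alpha(1)a\overline\alpha(1)$ for all $a,b\in A$; the system is *reversible* if one exists (it is then unique). Two systems $(A,\alpha)$, $(C,\gamma)$ are *equivalent* if there is a $*$-isomorphism $\Phi:A\to C$ with $\Phi\circ\alpha=\gamma\circ\Phi$. An ideal $I$ of $A$ is *positively invariant* if $\alpha(I)\subseteq I$, and then $\alpha_I(a+I)=\alpha(a)+I$ defines an endomorphism of $A/I$; it is *invariant* if moreover $(\ker\alpha)^\perp\cap\alpha^{-1}(I)\subseteq I$. Write $q_I:A\to A/I$ for the quotient map. Let $(A,\alpha)$ be a $C^*$-dynamical system and $J$ an ideal of $A$ with $J\subseteq(\ker\alpha)^\perp$.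 A *$J$-pair* for $(A,\alpha)$ is a pair $(I,I')$ of ideals of $A$ such that $I$ is positively invariant, $J\subseteq I'$ and $I'\cap\alpha^{-1}(I)=I$; $J$-pairs are ordered by inclusion in both entries. Put $A_n=\overline\alpha^n(1)A\overline\alpha^n(1)$ and $$B_n=q_J(A_0)\oplus\dots\oplus q_J(A_{n-1})\oplus A_n,\qquad T_n(x_0,\dots,x_{n-1},a)=(x_0,\dots,x_{n-1},q_J(a),\alpha(a)),$$ $$\beta_n(x_0,\dots,x_{n-1},a)=(x_1,\dots,x_{n-1},q_J(a),\alpha(a)).$$ The *natural reversible $J$-extension* $(B,\beta)$ of $(A,\alpha)$ is the $C^*$-inductive limit $B$ of $(B_n,T_n)_{n\ge0}$ with the endomorphism $\beta$ induced by the $\beta_n$. We identify $A=B_0$ and each $B_n$ with their images in $B$. **Theorem.** $(B,\beta)$ is a reversible $C^*$-dynamical system; its complete transfer operator $\beta_*$ is extendible, and we put $q=1-\overline{\beta_*}(1)\in M(B)$. The formulas $$I=\mathfrak J\cap A,\qquad I'=\{a\in A:\ qa\in\mathfrak J\}$$ define an order isomorphism $\mathfrak J\mapsto(I,I')$ from the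 set of invariant ideals of $(B,\beta)$, ordered by inclusion, onto the set of $J$-pairs for $(A,\alpha)$, and $\mathfrak J$ is recovered from $(I,I')$ by $$\mathfrak J\cap B_n=\sum_{k=0}^{n-1}\beta_*^k(qI')+\beta_*^n(I),\qquad n\ge 0.$$ In particular, the set of $J$-pairs is a lattice. Moreover, if $\mathfrak J$ corresponds to $(I,I')$, then $(B/\mathfrak J,\beta_{\mathfrak J})$ and $(A/I,\alpha_I)$ are $C^*$-dynamical systems, $q_I(I')\subseteq(\ker\alpha_I)^\perp$, and $(B/\mathfrak J,\beta_{\mathfrak J})$ is equivalent to the natural reversible $q_I(I')$-extension of $(A/I,\alpha_I)$. -/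

import Mathlib

open Filter Topology
open scoped MultiplierAlgebra ENNReal

noncomputable section

namespace CStarDyn

universe u v

/-! ### Approximate units -/

section ApproxUnit

variable {A : Type u} [NonUnitalCStarAlgebra A]

theorem norm_sub_mul_le {e : A} (he : ∃ c : A, e = star c * c) (he1 : ‖e‖ ≤ 1) (x : A) :
    ‖x - x * e‖ ≤ ‖x‖ := by
  let := CStarAlgebra.spectralOrder (Unitization ℂ A)
  have := CStarAlgebra.spectralOrderedRing (Unitization ℂ A)
  obtain ⟨c, hc⟩ := he
  have h0 : (0 : Unitization ℂ A) ≤ (e : Unitization ℂ A) := by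
    have : (e : Unitization ℂ A) = star (c : Unitization ℂ A) * (c : Unitization ℂ A) := by
      rw [hc]; simp
    rw [this]; exact star_mul_self_nonneg _
  have h1 : (e : Unitization ℂ A) ≤ 1 := by
    rw [← CStarAlgebra.norm_le_one_iff_of_nonneg _ h0, Unitization.norm_inr]; exact he1
  have h2 : ‖(1 : Unitization ℂ A) - e‖ ≤ 1 := by
    rw [CStarAlgebra.norm_le_one_iff_of_nonneg _ (sub_nonneg.2 h1)]
    exact sub_le_self _ h0
  have h3 : ((x - x * e : A) : Unitization ℂ A) = (x : Unitization ℂ A) * (1 - e) := by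
    rw [mul_sub, mul_one]; simp
  calc ‖x - x * e‖ = ‖((x - x * e : A) : Unitization ℂ A)‖ := (Unitization.norm_inr _).symm
    _ ≤ ‖(x : Unitization ℂ A)‖ * ‖(1 : Unitization ℂ A) - e‖ := by rw [h3]; exact norm_mul_le _ _
    _ ≤ ‖x‖ * 1 := by
      rw [Unitization.norm_inr]; exact mul_le_mul_of_nonneg_left h2 (norm_nonneg _)
    _ = ‖x‖ := mul_one _

/-- A filter on `A` which is a contractive approximate unit. -/
theorem exists_approxUnit (A : Type u) [NonUnitalCStarAlgebra A] :
    ∃ l : Filter A, l.IsApproximateUnit ∧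
      ∀ᶠ e in l, IsSelfAdjoint e ∧ (∃ c : A, e = star c * c) ∧ ‖e‖ ≤ 1 := by
  let := CStarAlgebra.spectralOrder A
  have := CStarAlgebra.spectralOrderedRing A
  have h := CStarAlgebra.increasingApproximateUnit A
  refine ⟨_, h.toIsApproximateUnit, ?_⟩
  filter_upwards [h.eventually_nonneg, h.eventually_norm] with e h0 h1
  exact ⟨.of_nonneg h0, CStarAlgebra.nonneg_iff_eq_star_mul_self.1 h0, h1⟩

theorem exists_approx_mul (K : NonUnitalStarSubalgebra ℂ A) (hK : IsClosed (K : Set A))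
    {c : A} (hc : c ∈ K) {ε : ℝ} (hε : 0 < ε) :
    ∃ e ∈ K, IsSelfAdjoint e ∧ (∀ x : A, ‖x - x * e‖ ≤ ‖x‖) ∧ ‖c - c * e‖ < ε := by
  have := hK
  obtain ⟨l, hl, h1⟩ := exists_approxUnit K
  have := hl.neBot
  have h2 := (Metric.tendsto_nhds.1 (hl.tendsto_mul_left ⟨c, hc⟩)) ε hε
  obtain ⟨e, ⟨he1, ⟨d, hd⟩, he3⟩, he4⟩ := (h1.and h2).exists
  refine ⟨e, e.2, ?_, fun x => norm_sub_mul_le ⟨(d : A), by rw [hd]; rfl⟩ he3 x, ?_⟩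
  · exact congrArg Subtype.val he1
  · rw [dist_comm, dist_eq_norm] at he4
    exact he4

theorem norm_mul_self_sub_le {a e : A} (hes : IsSelfAdjoint e)
    (hee : ∀ x : A, ‖x - x * e‖ ≤ ‖x‖) :
    ‖a - a * e‖ * ‖a - a * e‖ ≤ ‖star a * a - star a * a * e‖ := by
  rw [← CStarRing.norm_star_mul_self]
  have hs : star (a - a * e) * (a - a * e)
      = star (star (star a * a - star a * a * e) - star (star a * a - star a * a * e) * e) := by
    simp only [star_sub, star_mul, star_star, hes.star_eq]
    noncomm_ring
  rw [hs, norm_star, ← norm_star (star a * a - star a * a * e)]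
  exact hee _

end ApproxUnit

/-! ### Ideals and quotients -/

/-- An ideal of a `C*`-algebra: a norm closed two-sided ideal. -/
@[ext]
structure ClosedIdeal (A : Type u) [NonUnitalCStarAlgebra A] extends Submodule ℂ A where
  mul_mem_left' : ∀ (a : A) {x : A}, x ∈ carrier → a * x ∈ carrier
  mul_mem_right' : ∀ (a : A) {x : A}, x ∈ carrier → x * a ∈ carrier
  isClosed' : IsClosed carrier

namespace ClosedIdeal

variable {A : Type u} [NonUnitalCStarAlgebra A]

instance : SetLike (ClosedIdeal A) A where
  coe I := I.carrier
  coe_injective _ _ h := ClosedIdeal.ext h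

/-- Ideals are ordered by inclusion. -/
instance : PartialOrder (ClosedIdeal A) := .ofSetLike (ClosedIdeal A) A

instance : AddSubgroupClass (ClosedIdeal A) A where
  add_mem {I} _ _ ha hb := I.add_mem ha hb
  zero_mem I := I.zero_mem
  neg_mem {I} _ ha := I.toSubmodule.neg_mem ha

theorem isClosed (I : ClosedIdeal A) : IsClosed (I : Set A) := I.isClosed'

instance (I : ClosedIdeal A) : IsClosed (I.toSubmodule : Set A) := I.isClosed'

theorem mul_mem_left (I : ClosedIdeal A) (a : A) {x : A} (hx : x ∈ I) : a * x ∈ I :=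
  I.mul_mem_left' a hx

theorem mul_mem_right (I : ClosedIdeal A) (a : A) {x : A} (hx : x ∈ I) : x * a ∈ I :=
  I.mul_mem_right' a hx

theorem smul_mem (I : ClosedIdeal A) (c : ℂ) {x : A} (hx : x ∈ I) : c • x ∈ I :=
  I.toSubmodule.smul_mem c hx

theorem star_mem (I : ClosedIdeal A) {a : A} (ha : a ∈ I) : star a ∈ I := by
  let K : NonUnitalStarSubalgebra ℂ A :=
    { carrier := {x | x ∈ I ∧ star x ∈ I}
      add_mem' := fun h h' => ⟨add_mem h.1 h'.1, by rw [star_add]; exact add_mem h.2 h'.2⟩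
      zero_mem' := ⟨zero_mem I, by rw [star_zero]; exact zero_mem I⟩
      mul_mem' := fun {x y} h h' =>
        ⟨I.mul_mem_left _ h'.1, by rw [star_mul]; exact I.mul_mem_left _ h.2⟩
      smul_mem' := fun c x h =>
        ⟨I.smul_mem c h.1, by rw [star_smul]; exact I.smul_mem _ h.2⟩
      star_mem' := fun {x} h => ⟨h.2, by rw [star_star]; exact h.1⟩ }
  have hK : IsClosed (K : Set A) := I.isClosed.inter (I.isClosed.preimage continuous_star)
  have hc : a * star a ∈ K :=
    ⟨I.mul_mem_right _ ha, by rw [star_mul, star_star]; exact I.mul_mem_right _ ha⟩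
  have hcl : star a ∈ closure (I : Set A) := by
    rw [Metric.mem_closure_iff]
    intro ε hε
    obtain ⟨e, heK, hes, hee, hce⟩ := exists_approx_mul K hK hc (ε := ε ^ 2) (by positivity)
    refine ⟨star a * e, I.mul_mem_left _ heK.1, ?_⟩
    rw [dist_eq_norm]
    refine lt_of_pow_lt_pow_left₀ 2 hε.le ?_
    have h := norm_mul_self_sub_le (a := star a) hes hee
    rw [star_star] at h
    rw [sq]
    exact h.trans_lt hce
  rwa [I.isClosed.closure_eq] at hcl

/-- The quotient `C*`-algebra `A / I`. -/
def Quot (I : ClosedIdeal A) : Type u := A ⧸ I.toSubmodule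

variable (I : ClosedIdeal A)

instance : NormedAddCommGroup I.Quot :=
  inferInstanceAs (NormedAddCommGroup (A ⧸ I.toSubmodule))

instance : NormedSpace ℂ I.Quot := inferInstanceAs (NormedSpace ℂ (A ⧸ I.toSubmodule))

instance : CompleteSpace I.Quot := inferInstanceAs (CompleteSpace (A ⧸ I.toSubmodule))

/-- The quotient map, as a plain function. -/
def toQuot (a : A) : I.Quot := Submodule.Quotient.mk a

theorem toQuot_surjective : Function.Surjective I.toQuot := Submodule.Quotient.mk_surjective _

variable {I} in
theorem toQuot_eq_iff {a b : A} : I.toQuot a = I.toQuot b ↔ a - b ∈ I := Submodule.Quotient.eq _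

variable {I} in
theorem toQuot_eq_zero {a : A} : I.toQuot a = 0 ↔ a ∈ I := Submodule.Quotient.mk_eq_zero _

theorem toQuot_add (a b : A) : I.toQuot (a + b) = I.toQuot a + I.toQuot b := rfl
theorem toQuot_zero : I.toQuot 0 = 0 := rfl
theorem toQuot_smul (c : ℂ) (a : A) : I.toQuot (c • a) = c • I.toQuot a := rfl
theorem norm_toQuot_le (a : A) : ‖I.toQuot a‖ ≤ ‖a‖ := Submodule.Quotient.norm_mk_le _ a
theorem exists_norm_lt (x : I.Quot) {ε : ℝ} (hε : 0 < ε) : ∃ a, I.toQuot a = x ∧ ‖a‖ < ‖x‖ + ε :=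
  Submodule.Quotient.norm_mk_lt x hε

instance : Mul I.Quot where
  mul := Quotient.map₂ (· * ·) fun a a' h b b' h' => by
    have h1 : a - a' ∈ I := (Submodule.quotientRel_def _).1 h
    have h2 : b - b' ∈ I := (Submodule.quotientRel_def _).1 h'
    refine (Submodule.quotientRel_def _).2 ?_
    have : a * b - a' * b' = (a - a') * b + a' * (b - b') := by noncomm_ring
    rw [this]
    exact add_mem (I.mul_mem_right b h1) (I.mul_mem_left a' h2)

instance : Star I.Quot where
  star := Quotient.map star fun a a' h => by
    have h1 : a - a' ∈ I := (Submodule.quotientRel_def _).1 h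
    refine (Submodule.quotientRel_def _).2 ?_
    rw [← star_sub]
    exact I.star_mem h1

theorem toQuot_mul (a b : A) : I.toQuot (a * b) = I.toQuot a * I.toQuot b := rfl
theorem toQuot_star (a : A) : I.toQuot (star a) = star (I.toQuot a) := rfl

instance : NonUnitalRing I.Quot where
  __ := (inferInstance : AddCommGroup I.Quot)
  left_distrib x y z := by
    obtain ⟨a, rfl⟩ := I.toQuot_surjective x
    obtain ⟨b, rfl⟩ := I.toQuot_surjective y
    obtain ⟨c, rfl⟩ := I.toQuot_surjective z
    exact congrArg I.toQuot (mul_add a b c)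
  right_distrib x y z := by
    obtain ⟨a, rfl⟩ := I.toQuot_surjective x
    obtain ⟨b, rfl⟩ := I.toQuot_surjective y
    obtain ⟨c, rfl⟩ := I.toQuot_surjective z
    exact congrArg I.toQuot (add_mul a b c)
  zero_mul x := by
    obtain ⟨a, rfl⟩ := I.toQuot_surjective x
    exact congrArg I.toQuot (zero_mul a)
  mul_zero x := by
    obtain ⟨a, rfl⟩ := I.toQuot_surjective x
    exact congrArg I.toQuot (mul_zero a)
  mul_assoc x y z := by
    obtain ⟨a, rfl⟩ := I.toQuot_surjective x
    obtain ⟨b, rfl⟩ := I.toQuot_surjective y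
    obtain ⟨c, rfl⟩ := I.toQuot_surjective z
    exact congrArg I.toQuot (mul_assoc a b c)

instance : NonUnitalNormedRing I.Quot where
  __ := (inferInstance : NormedAddCommGroup I.Quot)
  __ := (inferInstance : NonUnitalRing I.Quot)
  norm_mul_le x y := by
    refine le_of_forall_pos_le_add fun ε hε => ?_
    have hlim : Tendsto (fun δ : ℝ => (‖x‖ + δ) * (‖y‖ + δ)) (𝓝[>] 0) (𝓝 (‖x‖ * ‖y‖)) := by
      have : Tendsto (fun δ : ℝ => (‖x‖ + δ) * (‖y‖ + δ)) (𝓝 0) (𝓝 ((‖x‖ + 0) * (‖y‖ + 0))) :=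
        Continuous.tendsto (by fun_prop) 0
      simp only [add_zero] at this
      exact this.mono_left nhdsWithin_le_nhds
    have h2 := (hlim.eventually_lt_const (lt_add_of_pos_right _ hε)).and self_mem_nhdsWithin
    obtain ⟨δ, hδ, hδ0⟩ := h2.exists
    obtain ⟨a, rfl, ha⟩ := I.exists_norm_lt x hδ0
    obtain ⟨b, rfl, hb⟩ := I.exists_norm_lt y hδ0
    calc ‖I.toQuot (a * b)‖ ≤ ‖a * b‖ := I.norm_toQuot_le _
      _ ≤ ‖a‖ * ‖b‖ := norm_mul_le _ _
      _ ≤ (‖I.toQuot a‖ + δ) * (‖I.toQuot b‖ + δ) :=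
        mul_le_mul ha.le hb.le (norm_nonneg _) (add_nonneg (norm_nonneg _) (le_of_lt hδ0))
      _ ≤ _ := hδ.le

instance : StarRing I.Quot where
  star_involutive x := by
    obtain ⟨a, rfl⟩ := I.toQuot_surjective x
    exact congrArg I.toQuot (star_star a)
  star_mul x y := by
    obtain ⟨a, rfl⟩ := I.toQuot_surjective x
    obtain ⟨b, rfl⟩ := I.toQuot_surjective y
    exact congrArg I.toQuot (star_mul a b)
  star_add x y := by
    obtain ⟨a, rfl⟩ := I.toQuot_surjective x
    obtain ⟨b, rfl⟩ := I.toQuot_surjective y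
    exact congrArg I.toQuot (star_add a b)

/-- An ideal as a closed `*`-subalgebra. -/
def toStarSubalgebra : NonUnitalStarSubalgebra ℂ A where
  carrier := I
  add_mem' := add_mem
  zero_mem' := zero_mem I
  mul_mem' _ h := I.mul_mem_left _ h
  smul_mem' c _ h := I.smul_mem c h
  star_mem' h := I.star_mem h

instance : CStarRing I.Quot where
  norm_mul_self_le x := by
    obtain ⟨a, rfl⟩ := I.toQuot_surjective x
    refine le_of_forall_pos_le_add fun ε hε => ?_
    obtain ⟨b, hb, hbn⟩ := I.exists_norm_lt (I.toQuot (star a * a)) (half_pos hε)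
    have hj : star a * a - b ∈ I := toQuot_eq_iff.1 hb.symm
    obtain ⟨e, heI, hes, hee, hje⟩ :=
      exists_approx_mul I.toStarSubalgebra I.isClosed hj (half_pos hε)
    have h1 : ‖I.toQuot a‖ ≤ ‖a - a * e‖ := by
      have : I.toQuot a = I.toQuot (a - a * e) := by
        rw [toQuot_eq_iff]
        simpa using I.mul_mem_left a heI
      rw [this]; exact I.norm_toQuot_le _
    have h2 : star a * a - star a * a * e
        = (b - b * e) + ((star a * a - b) - (star a * a - b) * e) := by noncomm_ring
    calc ‖I.toQuot a‖ * ‖I.toQuot a‖ ≤ ‖a - a * e‖ * ‖a - a * e‖ :=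
          mul_le_mul h1 h1 (norm_nonneg _) (norm_nonneg _)
      _ ≤ ‖star a * a - star a * a * e‖ := norm_mul_self_sub_le hes hee
      _ ≤ ‖b - b * e‖ + ‖(star a * a - b) - (star a * a - b) * e‖ := by
        rw [h2]; exact norm_add_le _ _
      _ ≤ (‖I.toQuot (star a * a)‖ + ε / 2) + ε / 2 := add_le_add ((hee b).trans hbn.le) hje.le
      _ = ‖star (I.toQuot a) * I.toQuot a‖ + ε := by rw [toQuot_mul, toQuot_star]; ring

instance : NonUnitalCStarAlgebra I.Quot where
  smul_assoc c x y := by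
    obtain ⟨a, rfl⟩ := I.toQuot_surjective x
    obtain ⟨b, rfl⟩ := I.toQuot_surjective y
    exact congrArg I.toQuot (smul_mul_assoc c a b)
  smul_comm c x y := by
    obtain ⟨a, rfl⟩ := I.toQuot_surjective x
    obtain ⟨b, rfl⟩ := I.toQuot_surjective y
    exact congrArg I.toQuot (mul_smul_comm c a b).symm
  star_smul c x := by
    obtain ⟨a, rfl⟩ := I.toQuot_surjective x
    exact congrArg I.toQuot (star_smul c a)

/-- The quotient map `A → A / I`. -/
def quotHom : A →⋆ₙₐ[ℂ] I.Quot where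
  toFun := I.toQuot
  map_smul' _ _ := rfl
  map_zero' := rfl
  map_add' _ _ := rfl
  map_mul' _ _ := rfl
  map_star' _ := rfl

end ClosedIdeal

namespace ClosedIdeal

variable {A : Type u} [NonUnitalCStarAlgebra A] {B : Type v} [NonUnitalCStarAlgebra B]

/-- The annihilator `{a | a I = 0}`. -/
def annihilator (I : ClosedIdeal A) : ClosedIdeal A where
  carrier := {a | ∀ x ∈ I, a * x = 0}
  add_mem' ha hb x hx := by rw [add_mul, ha x hx, hb x hx, add_zero]
  zero_mem' x _ := zero_mul x
  smul_mem' c a ha x hx := by rw [smul_mul_assoc, ha x hx, smul_zero]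
  mul_mem_left' a b hb x hx := by rw [mul_assoc, hb x hx, mul_zero]
  mul_mem_right' a b hb x hx := by rw [mul_assoc, hb _ (I.mul_mem_left a hx)]
  isClosed' := by
    have : {a : A | ∀ x ∈ I, a * x = 0} = ⋂ x ∈ I, {a | a * x = 0} := by ext; simp
    rw [this]
    exact isClosed_biInter fun x _ => isClosed_eq (by fun_prop) continuous_const

theorem continuous_hom (f : A →⋆ₙₐ[ℂ] B) : Continuous f :=
  AddMonoidHomClass.continuous_of_bound f 1 fun x => by
    rw [one_mul]; exact NonUnitalStarAlgHom.norm_apply_le f x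

/-- The kernel of a homomorphism. -/
def ker (f : A →⋆ₙₐ[ℂ] B) : ClosedIdeal A where
  carrier := {a | f a = 0}
  add_mem' {a b} (ha : f a = 0) (hb : f b = 0) := by
    change f (a + b) = 0; rw [map_add, ha, hb, add_zero]
  zero_mem' := map_zero f
  smul_mem' c a (ha : f a = 0) := by change f (c • a) = 0; rw [map_smul, ha, smul_zero]
  mul_mem_left' a b (hb : f b = 0) := by change f (a * b) = 0; rw [map_mul, hb, mul_zero]
  mul_mem_right' a b (hb : f b = 0) := by change f (b * a) = 0; rw [map_mul, hb, zero_mul]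
  isClosed' := isClosed_eq (continuous_hom f) continuous_const

/-- The homomorphism `A / I → B / K` induced by `f : A → B` with `f(I) ⊆ K`. -/
def quotMap (f : A →⋆ₙₐ[ℂ] B) (I : ClosedIdeal A) (K : ClosedIdeal B)
    (h : ∀ a ∈ I, f a ∈ K) : I.Quot →⋆ₙₐ[ℂ] K.Quot where
  toFun := Quotient.map f fun a a' haa' => by
    have h1 : a - a' ∈ I := (Submodule.quotientRel_def _).1 haa'
    refine (Submodule.quotientRel_def _).2 ?_
    rw [← map_sub]
    exact h _ h1
  map_smul' c x := by
    obtain ⟨a, rfl⟩ := I.toQuot_surjective x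
    exact congrArg K.toQuot (map_smul f c a)
  map_zero' := congrArg K.toQuot (map_zero f)
  map_add' x y := by
    obtain ⟨a, rfl⟩ := I.toQuot_surjective x
    obtain ⟨b, rfl⟩ := I.toQuot_surjective y
    exact congrArg K.toQuot (map_add f a b)
  map_mul' x y := by
    obtain ⟨a, rfl⟩ := I.toQuot_surjective x
    obtain ⟨b, rfl⟩ := I.toQuot_surjective y
    exact congrArg K.toQuot (map_mul f a b)
  map_star' x := by
    obtain ⟨a, rfl⟩ := I.toQuot_surjective x
    exact congrArg K.toQuot (map_star f a)

theorem quotMap_toQuot (f : A →⋆ₙₐ[ℂ] B) (I : ClosedIdeal A) (K : ClosedIdeal B)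
    (h : ∀ a ∈ I, f a ∈ K) (a : A) : quotMap f I K h (I.toQuot a) = K.toQuot (f a) := rfl

theorem isQuotientMap_toQuot (I : ClosedIdeal A) : IsQuotientMap I.toQuot :=
  (QuotientAddGroup.isOpenQuotientMap_mk (N := I.toSubmodule.toAddSubgroup)).isQuotientMap

/-- For `I ⊆ I'`, the image of the ideal `I'` in the quotient `A / I`. -/
def image (I I' : ClosedIdeal A) (h : I ≤ I') : ClosedIdeal I.Quot where
  carrier := I.toQuot '' I'
  add_mem' := by
    rintro _ _ ⟨a, ha, rfl⟩ ⟨b, hb, rfl⟩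
    exact ⟨a + b, add_mem ha hb, rfl⟩
  zero_mem' := ⟨0, zero_mem I', rfl⟩
  smul_mem' := by
    rintro c _ ⟨a, ha, rfl⟩
    exact ⟨c • a, I'.smul_mem c ha, rfl⟩
  mul_mem_left' := by
    rintro x _ ⟨a, ha, rfl⟩
    obtain ⟨b, rfl⟩ := I.toQuot_surjective x
    exact ⟨b * a, I'.mul_mem_left b ha, rfl⟩
  mul_mem_right' := by
    rintro x _ ⟨a, ha, rfl⟩
    obtain ⟨b, rfl⟩ := I.toQuot_surjective x
    exact ⟨a * b, I'.mul_mem_right b ha, rfl⟩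
  isClosed' := by
    rw [← I.isQuotientMap_toQuot.isClosed_preimage]
    have : I.toQuot ⁻¹' (I.toQuot '' I') = I' := by
      ext a
      constructor
      · rintro ⟨b, hb, hab⟩
        have h1 : b - a ∈ I' := h (toQuot_eq_iff.1 hab)
        have := sub_mem hb h1
        simpa using this
      · intro ha
        exact ⟨a, ha, rfl⟩
    rw [this]
    exact I'.isClosed

end ClosedIdeal

/-! ### Multipliers, the strict topology and extendible maps -/

section Multiplier

variable {A : Type u} [NonUnitalCStarAlgebra A] {B : Type v} [NonUnitalCStarAlgebra B]

/-- `A` regarded as a subalgebra of its multiplier algebra. -/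
def toMul (a : A) : 𝓜(ℂ, A) := DoubleCentralizer.coe ℂ a

/-- The product `m a ∈ A` of a multiplier `m` and `a ∈ A`. -/
def mulL (m : 𝓜(ℂ, A)) (a : A) : A := m.fst a

/-- The product `a m ∈ A` of `a ∈ A` and a multiplier `m`. -/
def mulR (a : A) (m : 𝓜(ℂ, A)) : A := m.snd a

/-- The strict topology of `M(A)`: the topology generated by the maps `m ↦ m a` and `m ↦ m* a`,
for `a ∈ A`. -/
@[reducible] def strictTopology (A : Type u) [NonUnitalCStarAlgebra A] : TopologicalSpace 𝓜(ℂ, A) :=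
  TopologicalSpace.induced
    (fun m => ((fun a => mulL m a, fun a => mulL (star m) a) : (A → A) × (A → A))) inferInstance

/-- `E` is a strictly continuous extension of `T : A → B` to the multiplier algebras. -/
structure IsStrictExtension (T : A → B) (E : 𝓜(ℂ, A) → 𝓜(ℂ, B)) : Prop where
  continuous : Continuous[strictTopology A, strictTopology B] E
  extends_map : ∀ a, E (toMul a) = toMul (T a)

/-- A map is extendible if it has a strictly continuous extension to the multiplier algebras. -/
def Extendible (T : A → B) : Prop := ∃ E, IsStrictExtension T E

/-- The (unique) strictly continuous extension of an extendible map. -/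
def Extendible.ext {T : A → B} (h : Extendible T) : 𝓜(ℂ, A) → 𝓜(ℂ, B) := h.choose

theorem Extendible.ext_spec {T : A → B} (h : Extendible T) : IsStrictExtension T h.ext :=
  h.choose_spec

theorem mul_ext {m n : 𝓜(ℂ, A)} (h : ∀ a, mulL m a = mulL n a) : m = n := by
  have h1 : m.fst = n.fst := ContinuousLinearMap.ext h
  have h2 : (m - n).fst = 0 := by rw [DoubleCentralizer.sub_fst, h1, sub_self]
  rw [← sub_eq_zero, ← norm_eq_zero, ← DoubleCentralizer.norm_fst, h2, norm_zero]

theorem mulL_toMul (a b : A) : mulL (toMul a) b = a * b := rfl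
theorem mulR_toMul (a b : A) : mulR a (toMul b) = a * b := rfl
theorem mulL_mul (m n : 𝓜(ℂ, A)) (a : A) : mulL (m * n) a = mulL m (mulL n a) := rfl
theorem mulL_one (a : A) : mulL (1 : 𝓜(ℂ, A)) a = a := rfl
theorem mulR_one (a : A) : mulR a (1 : 𝓜(ℂ, A)) = a := rfl

theorem mulR_mul_eq (m : 𝓜(ℂ, A)) (a b : A) : mulR a m * b = a * mulL m b := m.central a b

theorem toMul_mul (a b : A) : toMul (a * b) = toMul a * toMul b :=
  mul_ext fun c => by simp [mulL_mul, mulL_toMul, mul_assoc]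

theorem toMul_star (a : A) : toMul (star a) = star (toMul a) :=
  mul_ext fun c => by
    change star a * c = star ((toMul a).snd (star c))
    rw [show (toMul a).snd (star c) = star c * a from rfl, star_mul, star_star]

theorem eq_of_mul_right {a b : A} (h : ∀ c, a * c = b * c) : a = b := by
  have : (a - b) * star (a - b) = 0 := by rw [sub_mul, h, sub_self]
  rw [CStarRing.mul_star_self_eq_zero_iff] at this
  exact sub_eq_zero.1 this

theorem toMul_injective : Function.Injective (toMul : A → 𝓜(ℂ, A)) := fun _ _ h =>
  eq_of_mul_right fun c => congrArg (fun m => mulL m c) h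

theorem mulL_mul_right (m : 𝓜(ℂ, A)) (a b : A) : mulL m (a * b) = mulL m a * b := by
  have key : ∀ c : A, c * mulL m (a * b) = c * (mulL m a * b) := fun c => by
    rw [← mulR_mul_eq, ← mul_assoc, ← mul_assoc, mulR_mul_eq]
  have := eq_of_mul_right (a := star (mulL m (a * b))) (b := star (mulL m a * b)) fun c => by
    have := congrArg star (key (star c))
    simpa only [star_mul, star_star] using this
  exact star_injective this

theorem toMul_mulL (m : 𝓜(ℂ, A)) (a : A) : toMul (mulL m a) = m * toMul a :=
  mul_ext fun c => by rw [mulL_mul, mulL_toMul, mulL_toMul, mulL_mul_right]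

theorem toMul_mulR (m : 𝓜(ℂ, A)) (a : A) : toMul (mulR a m) = toMul a * m :=
  mul_ext fun c => by rw [mulL_mul, mulL_toMul, mulL_toMul, mulR_mul_eq]

theorem tendsto_strict_iff {ι : Type*} {l : Filter ι} {f : ι → 𝓜(ℂ, A)} {m : 𝓜(ℂ, A)} :
    Tendsto f l (@nhds _ (strictTopology A) m) ↔
      (∀ a, Tendsto (fun i => mulL (f i) a) l (𝓝 (mulL m a))) ∧
      ∀ a, Tendsto (fun i => mulL (star (f i)) a) l (𝓝 (mulL (star m) a)) := by
  rw [strictTopology, nhds_induced, tendsto_comap_iff, nhds_prod_eq, tendsto_prod_iff',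
    tendsto_pi_nhds, tendsto_pi_nhds]
  rfl

theorem strict_unique {ι : Type*} {l : Filter ι} [l.NeBot] {f : ι → 𝓜(ℂ, A)} {m n : 𝓜(ℂ, A)}
    (h : Tendsto f l (@nhds _ (strictTopology A) m))
    (h' : Tendsto f l (@nhds _ (strictTopology A) n)) : m = n :=
  mul_ext fun a => tendsto_nhds_unique ((tendsto_strict_iff.1 h).1 a) ((tendsto_strict_iff.1 h').1 a)

theorem strict_mul_right {ι : Type*} {l : Filter ι} {f : ι → 𝓜(ℂ, A)} {m : 𝓜(ℂ, A)}
    (h : Tendsto f l (@nhds _ (strictTopology A) m)) (n : 𝓜(ℂ, A)) :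
    Tendsto (fun i => f i * n) l (@nhds _ (strictTopology A) (m * n)) := by
  rw [tendsto_strict_iff] at h ⊢
  refine ⟨fun a => h.1 (mulL n a), fun a => ?_⟩
  simp only [star_mul, mulL_mul]
  exact ((star n).fst.continuous.tendsto _).comp (h.2 a)

theorem strict_mul_left {ι : Type*} {l : Filter ι} {f : ι → 𝓜(ℂ, A)} {m : 𝓜(ℂ, A)}
    (h : Tendsto f l (@nhds _ (strictTopology A) m)) (n : 𝓜(ℂ, A)) :
    Tendsto (fun i => n * f i) l (@nhds _ (strictTopology A) (n * m)) := by
  rw [tendsto_strict_iff] at h ⊢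
  refine ⟨fun a => (n.fst.continuous.tendsto _).comp (h.1 a), fun a => ?_⟩
  simp only [star_mul, mulL_mul]
  exact h.2 _

theorem strict_star {ι : Type*} {l : Filter ι} {f : ι → 𝓜(ℂ, A)} {m : 𝓜(ℂ, A)}
    (h : Tendsto f l (@nhds _ (strictTopology A) m)) :
    Tendsto (fun i => star (f i)) l (@nhds _ (strictTopology A) (star m)) := by
  rw [tendsto_strict_iff] at h ⊢
  simpa only [star_star] using h.symm

/-- `A` is strictly dense in `M(A)`. -/
theorem exists_strict_approx (m : 𝓜(ℂ, A)) :
    ∃ (l : Filter A) (f : A → A), l.NeBot ∧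
      Tendsto (fun e => toMul (f e)) l (@nhds _ (strictTopology A) m) := by
  obtain ⟨l, hl, hs⟩ := exists_approxUnit A
  have := hl.neBot
  refine ⟨l, fun e => mulL m e, this, ?_⟩
  rw [tendsto_strict_iff]
  refine ⟨fun a => ?_, fun a => ?_⟩
  · simp only [mulL_toMul, ← mulL_mul_right]
    exact (m.fst.continuous.tendsto _).comp (hl.tendsto_mul_right a)
  · refine (hl.tendsto_mul_right (mulL (star m) a)).congr' ?_
    filter_upwards [hs] with e he
    rw [toMul_mulL, star_mul, ← toMul_star, he.1.star_eq, mulL_mul, mulL_toMul]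

theorem strict_ext_tendsto {T : A → B} (h : Extendible T) {ι : Type*} {l : Filter ι}
    {f : ι → 𝓜(ℂ, A)} {m : 𝓜(ℂ, A)} (hf : Tendsto f l (@nhds _ (strictTopology A) m)) :
    Tendsto (fun i => h.ext (f i)) l (@nhds _ (strictTopology B) (h.ext m)) :=
  (@Continuous.tendsto _ _ (strictTopology A) (strictTopology B) _
    h.ext_spec.continuous m).comp hf

variable {T : A →⋆ₙₐ[ℂ] B}

theorem ext_toMul (h : Extendible T) (a : A) : h.ext (toMul a) = toMul (T a) :=
  h.ext_spec.extends_map a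

theorem ext_mul_toMul (h : Extendible T) (m : 𝓜(ℂ, A)) (b : A) :
    h.ext (m * toMul b) = h.ext m * toMul (T b) := by
  obtain ⟨l, f, hl, hf⟩ := exists_strict_approx m
  have h1 := strict_ext_tendsto h (strict_mul_right hf (toMul b))
  have h2 := strict_mul_right (strict_ext_tendsto h hf) (toMul (T b))
  refine strict_unique h1 (h2.congr fun e => ?_)
  rw [← toMul_mul, ext_toMul, ext_toMul, ← toMul_mul, map_mul]

theorem ext_mul (h : Extendible T) (m n : 𝓜(ℂ, A)) : h.ext (m * n) = h.ext m * h.ext n := by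
  obtain ⟨l, f, hl, hf⟩ := exists_strict_approx n
  have h1 := strict_ext_tendsto h (strict_mul_left hf m)
  have h2 := strict_mul_left (strict_ext_tendsto h hf) (h.ext m)
  refine strict_unique h1 (h2.congr fun e => ?_)
  rw [ext_mul_toMul, ext_toMul]

theorem ext_star (h : Extendible T) (m : 𝓜(ℂ, A)) : h.ext (star m) = star (h.ext m) := by
  obtain ⟨l, f, hl, hf⟩ := exists_strict_approx m
  have h1 := strict_ext_tendsto h (strict_star hf)
  have h2 := strict_star (strict_ext_tendsto h hf)
  refine strict_unique h1 (h2.congr fun e => ?_)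
  rw [← toMul_star, ext_toMul, ext_toMul, ← toMul_star, map_star]

end Multiplier

/-! ### Dynamical systems and transfer operators -/

section Systems

variable {A : Type u} [NonUnitalCStarAlgebra A]

/-- A transfer operator for `(A, α)`: a positive linear map with `L(α(a)b) = aL(b)`. -/
structure IsTransferOperator (α : A →⋆ₙₐ[ℂ] A) (L : A →ₗ[ℂ] A) : Prop where
  positive : ∀ a, ∃ c, L (star a * a) = star c * c
  transfer : ∀ a b, L (α a * b) = a * L b

/-- A complete transfer operator: a transfer operator with `α(L(a)) = α̅(1) a α̅(1)`. -/
structure IsCompleteTransferOperator (α : A →⋆ₙₐ[ℂ] A) (hα : Extendible α)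
    (L : A →ₗ[ℂ] A) : Prop extends IsTransferOperator α L where
  complete : ∀ a, α (L a) = mulL (hα.ext 1) (mulR a (hα.ext 1))

/-- A system is reversible if it admits a complete transfer operator. -/
def IsReversible (α : A →⋆ₙₐ[ℂ] A) (hα : Extendible α) : Prop :=
  ∃ L : A →ₗ[ℂ] A, IsCompleteTransferOperator α hα L

/-- Equivalence (isomorphism) of systems. -/
def SystemsEquivalent {A : Type u} {C : Type v} [NonUnitalCStarAlgebra A] [NonUnitalCStarAlgebra C]
    (α : A →⋆ₙₐ[ℂ] A) (γ : C →⋆ₙₐ[ℂ] C) : Prop :=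
  ∃ Φ : A ≃⋆ₐ[ℂ] C, ∀ a, Φ (α a) = γ (Φ a)

/-- `α(I) ⊆ I`. -/
def IsPositivelyInvariant (α : A →⋆ₙₐ[ℂ] A) (I : ClosedIdeal A) : Prop :=
  ∀ a ∈ I, α a ∈ I

/-- `J ∩ α⁻¹(I) ⊆ I`. -/
def IsNegativelyInvariant (α : A →⋆ₙₐ[ℂ] A) (J I : ClosedIdeal A) : Prop :=
  ∀ a ∈ J, α a ∈ I → a ∈ I

/-- An invariant ideal of `(A, α)`: positively invariant and `(ker α)^⊥`-negatively invariant. -/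
structure InvariantIdeal (α : A →⋆ₙₐ[ℂ] A) where
  ideal : ClosedIdeal A
  positive : IsPositivelyInvariant α ideal
  negative : IsNegativelyInvariant α (ClosedIdeal.ker α).annihilator ideal

/-- Invariant ideals are ordered by inclusion. -/
instance (α : A →⋆ₙₐ[ℂ] A) : PartialOrder (InvariantIdeal α) :=
  PartialOrder.lift InvariantIdeal.ideal fun x y h => by cases x; cases y; cases h; rfl

/-- A `J`-pair `(I, I')` for `(A, α)`. -/
structure JPair (α : A →⋆ₙₐ[ℂ] A) (J : ClosedIdeal A) where
  I : ClosedIdeal A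
  I' : ClosedIdeal A
  positive : IsPositivelyInvariant α I
  J_le : J ≤ I'
  inter_eq : (I' : Set A) ∩ α ⁻¹' I = I

theorem JPair.I_le {α : A →⋆ₙₐ[ℂ] A} {J : ClosedIdeal A} (P : JPair α J) : P.I ≤ P.I' :=
  fun a ha => by
    have h : a ∈ (P.I : Set A) := ha
    rw [← P.inter_eq] at h
    exact h.1

/-- `J`-pairs are ordered by inclusion in both entries. -/
instance (α : A →⋆ₙₐ[ℂ] A) (J : ClosedIdeal A) : PartialOrder (JPair α J) :=
  PartialOrder.lift (fun P => (P.I, P.I')) fun x y h => by cases x; cases y; cases h; rfl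

/-- The endomorphism `α_I(a + I) = α(a) + I` of `A / I`, for a positively invariant ideal `I`. -/
def quotEndo (α : A →⋆ₙₐ[ℂ] A) (I : ClosedIdeal A) (hI : IsPositivelyInvariant α I) :
    I.Quot →⋆ₙₐ[ℂ] I.Quot :=
  ClosedIdeal.quotMap α I I hI

end Systems

/-! ### Inductive limits of sequences of `C*`-algebras

For a sequence `X 0 → X 1 → X 2 → ...`, the limit is realized inside the quotient of the algebra of
bounded sequences in `∏ X n` by the ideal of null sequences. -/

section Limit

variable {X : ℕ → Type u} [∀ n, NonUnitalCStarAlgebra (X n)]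

/-- The ideal of null sequences in the algebra of bounded sequences. -/
def nullIdeal (X : ℕ → Type u) [∀ n, NonUnitalCStarAlgebra (X n)] : ClosedIdeal (lp X ∞) where
  carrier := {s | Tendsto (fun n => ‖s n‖) atTop (𝓝 0)}
  add_mem' {s t} hs ht := by
    refine squeeze_zero (fun n => norm_nonneg _) (fun n => norm_add_le (s n) (t n)) ?_
    simpa using Tendsto.add hs ht
  zero_mem' := by simp
  smul_mem' c s hs := by
    refine squeeze_zero (fun n => norm_nonneg _) (fun n => norm_smul_le c (s n)) ?_
    simpa using Tendsto.const_mul ‖c‖ hs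
  mul_mem_left' s t ht := by
    refine squeeze_zero (fun n => norm_nonneg _) (fun n => (norm_mul_le (s n) (t n)).trans
      (mul_le_mul_of_nonneg_right (lp.norm_apply_le_norm ENNReal.top_ne_zero s n)
        (norm_nonneg _))) ?_
    simpa using Tendsto.const_mul ‖s‖ ht
  mul_mem_right' s t ht := by
    refine squeeze_zero (fun n => norm_nonneg _) (fun n => (norm_mul_le (t n) (s n)).trans
      (mul_le_mul_of_nonneg_left (lp.norm_apply_le_norm ENNReal.top_ne_zero s n)
        (norm_nonneg _))) ?_
    simpa using Tendsto.mul_const ‖s‖ ht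
  isClosed' := by
    refine isClosed_of_closure_subset fun s hs => ?_
    change Tendsto (fun n => ‖s n‖) atTop (𝓝 0)
    rw [Metric.tendsto_atTop]
    intro ε hε
    obtain ⟨t, ht, hst⟩ := Metric.mem_closure_iff.1 hs (ε / 2) (half_pos hε)
    obtain ⟨N, hN⟩ := Metric.tendsto_atTop.1 ht (ε / 2) (half_pos hε)
    refine ⟨N, fun n hn => ?_⟩
    have h1 := hN n hn
    rw [Real.dist_eq, sub_zero, abs_norm] at h1 ⊢
    have h2 : ‖s n - t n‖ ≤ ‖s - t‖ := lp.norm_apply_le_norm ENNReal.top_ne_zero (s - t) n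
    rw [dist_eq_norm] at hst
    calc ‖s n‖ = ‖(s n - t n) + t n‖ := by rw [sub_add_cancel]
      _ ≤ ‖s n - t n‖ + ‖t n‖ := norm_add_le _ _
      _ < ε := by linarith

/-- The map on bounded sequences induced by homomorphisms `g n : Y → X n`. -/
def seqHom {Y : Type u} [NonUnitalCStarAlgebra Y] (g : ∀ n, Y →⋆ₙₐ[ℂ] X n) :
    Y →⋆ₙₐ[ℂ] lp X ∞ where
  toFun y := ⟨fun n => g n y, memℓp_infty ⟨‖y‖, by
    rintro _ ⟨n, rfl⟩
    exact NonUnitalStarAlgHom.norm_apply_le (g n) y⟩⟩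
  map_smul' c y := lp.ext (funext fun n => map_smul (g n) c y)
  map_zero' := lp.ext (funext fun n => map_zero (g n))
  map_add' y z := lp.ext (funext fun n => map_add (g n) y z)
  map_mul' y z := lp.ext (funext fun n => map_mul (g n) y z)
  map_star' y := lp.ext (funext fun n => map_star (g n) y)

/-- The coordinate projections of the algebra of bounded sequences. -/
def evalHom (X : ℕ → Type u) [∀ n, NonUnitalCStarAlgebra (X n)] (n : ℕ) :
    lp X ∞ →⋆ₙₐ[ℂ] X n where
  toFun s := s n
  map_smul' _ _ := rfl
  map_zero' := rfl
  map_add' _ _ := rfl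
  map_mul' _ _ := rfl
  map_star' _ := rfl

/-- The composite `X n → X m` of the bonding maps `T n`, ..., `T (m - 1)`, for `n ≤ m`. -/
def transition (T : ∀ n, X n →⋆ₙₐ[ℂ] X (n + 1)) {n m : ℕ} (h : n ≤ m) : X n →⋆ₙₐ[ℂ] X m :=
  Nat.leRecOn (C := fun m => X n →⋆ₙₐ[ℂ] X m) h (fun {k} f => (T k).comp f)
    (NonUnitalStarAlgHom.id ℂ (X n))

/-- The ambient algebra of the limit: bounded sequences modulo null sequences. -/
abbrev SeqQuot (X : ℕ → Type u) [∀ n, NonUnitalCStarAlgebra (X n)] : Type u := (nullIdeal X).Quot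

/-- The canonical map `φ n` from `X n` to the limit: `b` is sent to the class of the sequence
`(0, ..., 0, b, T b, T (T b), ...)` with `b` in position `n`. -/
def limMap (T : ∀ n, X n →⋆ₙₐ[ℂ] X (n + 1)) (n : ℕ) : X n →⋆ₙₐ[ℂ] SeqQuot X :=
  (nullIdeal X).quotHom.comp
    (seqHom fun m => if h : n ≤ m then transition T h else 0)

/-- The endomorphism induced on the limit by endomorphisms `f n : X n → X n`. -/
def limEndo (f : ∀ n, X n →⋆ₙₐ[ℂ] X n) : SeqQuot X →⋆ₙₐ[ℂ] SeqQuot X :=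
  ClosedIdeal.quotMap (seqHom fun n => (f n).comp (evalHom X n)) _ _ fun s hs =>
    squeeze_zero (fun n => norm_nonneg _)
      (fun n => NonUnitalStarAlgHom.norm_apply_le (f n) (s n)) hs

theorem transition_comm (T : ∀ n, X n →⋆ₙₐ[ℂ] X (n + 1)) (f : ∀ n, X n →⋆ₙₐ[ℂ] X n)
    (hf : ∀ n x, T n (f n x) = f (n + 1) (T n x)) {n m : ℕ} (h : n ≤ m) (x : X n) :
    transition T h (f n x) = f m (transition T h x) := by
  induction m, h using Nat.le_induction with
  | base =>
    unfold transition
    rw [Nat.leRecOn_self]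
    rfl
  | succ m h ih =>
    have key : ∀ y, transition T (Nat.le_succ_of_le h) y = T m (transition T h y) := fun y => by
      unfold transition
      rw [Nat.leRecOn_succ h]
      rfl
    rw [key, key, ih, hf]

theorem limEndo_limMap (T : ∀ n, X n →⋆ₙₐ[ℂ] X (n + 1)) (f : ∀ n, X n →⋆ₙₐ[ℂ] X n)
    (hf : ∀ n x, T n (f n x) = f (n + 1) (T n x)) (n : ℕ) (x : X n) :
    limEndo f (limMap T n x) = limMap T n (f n x) := by
  refine congrArg (nullIdeal X).toQuot (lp.ext (funext fun m => ?_))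
  change f m ((if h : n ≤ m then transition T h else 0 : X n →⋆ₙₐ[ℂ] X m) x)
    = (if h : n ≤ m then transition T h else 0 : X n →⋆ₙₐ[ℂ] X m) (f n x)
  by_cases h : n ≤ m
  · simp only [h, dite_true]
    exact (transition_comm T f hf h x).symm
  · simp [h]

/-- The limit of a sequence of `*`-subalgebras `S n ⊆ X n` with `T n (S n) ⊆ S (n + 1)`: the norm
closure of the union of the increasing sequence of subalgebras `φ n (S n)`. -/
def limSubalgebra (T : ∀ n, X n →⋆ₙₐ[ℂ] X (n + 1)) (S : ∀ n, NonUnitalStarSubalgebra ℂ (X n)) :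
    NonUnitalStarSubalgebra ℂ (SeqQuot X) :=
  (⨆ n, (S n).map (limMap T n)).topologicalClosure

theorem limMap_mem (T : ∀ n, X n →⋆ₙₐ[ℂ] X (n + 1)) (S : ∀ n, NonUnitalStarSubalgebra ℂ (X n))
    {n : ℕ} {x : X n} (hx : x ∈ S n) : limMap T n x ∈ limSubalgebra T S :=
  NonUnitalStarSubalgebra.le_topologicalClosure _
    (le_iSup (fun n => (S n).map (limMap T n)) n ⟨x, hx, rfl⟩)

theorem limEndo_mem (T : ∀ n, X n →⋆ₙₐ[ℂ] X (n + 1)) (S : ∀ n, NonUnitalStarSubalgebra ℂ (X n))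
    (f : ∀ n, X n →⋆ₙₐ[ℂ] X n) (hf : ∀ n x, T n (f n x) = f (n + 1) (T n x))
    (hS : ∀ n, ∀ x ∈ S n, f n x ∈ S n) {y : SeqQuot X} (hy : y ∈ limSubalgebra T S) :
    limEndo f y ∈ limSubalgebra T S := by
  have h : limSubalgebra T S ≤ (limSubalgebra T S).comap (limEndo f) := by
    refine NonUnitalStarSubalgebra.topologicalClosure_minimal _ (iSup_le fun n => ?_) ?_
    · rintro _ ⟨x, hx, rfl⟩
      change limEndo f (limMap T n x) ∈ limSubalgebra T S
      rw [limEndo_limMap T f hf]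
      exact limMap_mem T S (hS n x hx)
    · exact (NonUnitalStarSubalgebra.isClosed_topologicalClosure
        (⨆ n, (S n).map (limMap T n))).preimage (ClosedIdeal.continuous_hom (limEndo f))
  exact h hy

end Limit

/-! ### The natural reversible extension -/

section NaturalExtension

variable {A : Type u} [NonUnitalCStarAlgebra A] {α : A →⋆ₙₐ[ℂ] A}

/-- The multiplier `α̅ⁿ(1)`. -/
def cornerUnit (hα : Extendible α) (n : ℕ) : 𝓜(ℂ, A) := hα.ext^[n] 1

theorem cornerUnit_succ (hα : Extendible α) (n : ℕ) :
    cornerUnit hα (n + 1) = hα.ext (cornerUnit hα n) :=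
  Function.iterate_succ_apply' _ _ _

theorem cornerUnit_mul_self (hα : Extendible α) (n : ℕ) :
    cornerUnit hα n * cornerUnit hα n = cornerUnit hα n := by
  induction n with
  | zero => exact one_mul _
  | succ n ih => rw [cornerUnit_succ, ← ext_mul, ih]

theorem star_cornerUnit (hα : Extendible α) (n : ℕ) :
    star (cornerUnit hα n) = cornerUnit hα n := by
  induction n with
  | zero => exact star_one _
  | succ n ih => rw [cornerUnit_succ, ← ext_star, ih]

theorem cornerUnit_mul_succ (hα : Extendible α) (n : ℕ) :
    cornerUnit hα n * cornerUnit hα (n + 1) = cornerUnit hα (n + 1) := by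
  induction n with
  | zero => exact one_mul _
  | succ n ih => rw [cornerUnit_succ _ n, cornerUnit_succ _ (n + 1), ← ext_mul, ih]

theorem cornerUnit_succ_mul (hα : Extendible α) (n : ℕ) :
    cornerUnit hα (n + 1) * cornerUnit hα n = cornerUnit hα (n + 1) := by
  have := congrArg star (cornerUnit_mul_succ hα n)
  rwa [star_mul, star_cornerUnit, star_cornerUnit] at this

/-- The compression `a ↦ p a p`, for a multiplier `p`. -/
def compress (p : 𝓜(ℂ, A)) (a : A) : A := mulL p (mulR a p)

theorem toMul_compress (p : 𝓜(ℂ, A)) (a : A) : toMul (compress p a) = p * toMul a * p := by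
  rw [compress, toMul_mulL, toMul_mulR, mul_assoc]

/-- The algebra `A_n = α̅ⁿ(1) A α̅ⁿ(1)`. -/
def corner (hα : Extendible α) (n : ℕ) : NonUnitalStarSubalgebra ℂ A where
  carrier := Set.range (compress (cornerUnit hα n))
  add_mem' := by
    rintro _ _ ⟨a, rfl⟩ ⟨b, rfl⟩
    exact ⟨a + b, by simp [compress, mulL, mulR]⟩
  zero_mem' := ⟨0, by simp [compress, mulL, mulR]⟩
  smul_mem' := by
    rintro c _ ⟨a, rfl⟩
    exact ⟨c • a, by simp [compress, mulL, mulR]⟩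
  mul_mem' := by
    rintro _ _ ⟨a, rfl⟩ ⟨b, rfl⟩
    refine ⟨a * compress (cornerUnit hα n) b, toMul_injective ?_⟩
    simp only [toMul_mul, toMul_compress, mul_assoc, cornerUnit_mul_self]
    simp only [← mul_assoc (cornerUnit hα n) (cornerUnit hα n), cornerUnit_mul_self]
  star_mem' := by
    rintro _ ⟨a, rfl⟩
    refine ⟨star a, toMul_injective ?_⟩
    simp only [toMul_star, toMul_compress, star_mul, star_cornerUnit, mul_assoc]

theorem map_mem_corner (hα : Extendible α) (n : ℕ) {a : A} (ha : a ∈ corner hα n) :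
    α a ∈ corner hα (n + 1) := by
  obtain ⟨b, rfl⟩ := ha
  refine ⟨α b, toMul_injective ?_⟩
  rw [← ext_toMul hα, toMul_compress, toMul_compress, ext_mul, ext_mul, ext_toMul, cornerUnit_succ]

theorem corner_succ_le (hα : Extendible α) (n : ℕ) : corner hα (n + 1) ≤ corner hα n := by
  rintro _ ⟨b, rfl⟩
  refine ⟨compress (cornerUnit hα (n + 1)) b, toMul_injective ?_⟩
  simp only [toMul_compress]
  rw [mul_assoc, mul_assoc, mul_assoc, cornerUnit_succ_mul, ← mul_assoc, cornerUnit_mul_succ,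
    mul_assoc]

/-- The algebra `(A / J)ⁿ ⊕ A`, which contains `B_n`. -/
abbrev Ambient (J : ClosedIdeal A) (n : ℕ) : Type u := (Fin n → J.Quot) × A

/-- The map `(x_0, ..., x_{n-1}, a) ↦ (x_0, ..., x_{n-1}, q(a), α(a))`. -/
def stepMap (α : A →⋆ₙₐ[ℂ] A) (J : ClosedIdeal A) (n : ℕ) :
    Ambient J n →⋆ₙₐ[ℂ] Ambient J (n + 1) where
  toFun x := (fun k => if h : k.1 < n then x.1 ⟨k.1, h⟩ else J.toQuot x.2, α x.2)
  map_smul' c x := by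
    refine Prod.ext (funext fun k => ?_) (map_smul α c x.2)
    by_cases h : k.1 < n <;> simp [h, J.toQuot_smul]
  map_zero' := by
    refine Prod.ext (funext fun k => ?_) (map_zero α)
    by_cases h : k.1 < n <;> simp [h, J.toQuot_zero]
  map_add' x y := by
    refine Prod.ext (funext fun k => ?_) (map_add α x.2 y.2)
    by_cases h : k.1 < n <;> simp [h, J.toQuot_add]
  map_mul' x y := by
    refine Prod.ext (funext fun k => ?_) (map_mul α x.2 y.2)
    by_cases h : k.1 < n <;> simp [h, J.toQuot_mul]
  map_star' x := by
    refine Prod.ext (funext fun k => ?_) (map_star α x.2)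
    by_cases h : k.1 < n <;> simp [h, J.toQuot_star]

/-- The map `(y_0, y_1, ..., y_n, a) ↦ (y_1, ..., y_n, a)`. -/
def shiftMap (J : ClosedIdeal A) (n : ℕ) : Ambient J (n + 1) →⋆ₙₐ[ℂ] Ambient J n where
  toFun y := (fun k => y.1 k.succ, y.2)
  map_smul' _ _ := rfl
  map_zero' := rfl
  map_add' _ _ := rfl
  map_mul' _ _ := rfl
  map_star' _ := rfl

/-- The endomorphism `β_n (x_0, x_1, ..., x_{n-1}, a) = (x_1, ..., x_{n-1}, q(a), α(a))`. -/
def stageEndo (α : A →⋆ₙₐ[ℂ] A) (J : ClosedIdeal A) (n : ℕ) :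
    Ambient J n →⋆ₙₐ[ℂ] Ambient J n :=
  (shiftMap J n).comp (stepMap α J n)

theorem stepMap_stageEndo (α : A →⋆ₙₐ[ℂ] A) (J : ClosedIdeal A) (n : ℕ) (x : Ambient J n) :
    stepMap α J n (stageEndo α J n x) = stageEndo α J (n + 1) (stepMap α J n x) := by
  refine Prod.ext (funext fun k => ?_) rfl
  simp only [stageEndo, stepMap, shiftMap, NonUnitalStarAlgHom.comp_apply,
    NonUnitalStarAlgHom.coe_mk', NonUnitalAlgHom.coe_mk]
  by_cases h : k.1 < n <;> simp [h]

/-- The algebra `B_n = q(A_0) ⊕ ... ⊕ q(A_{n-1}) ⊕ A_n`. -/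
def stage (hα : Extendible α) (J : ClosedIdeal A) (n : ℕ) :
    NonUnitalStarSubalgebra ℂ (Ambient J n) where
  carrier := {x | (∀ k : Fin n, x.1 k ∈ (corner hα k).map J.quotHom) ∧ x.2 ∈ corner hα n}
  add_mem' h h' := ⟨fun k => add_mem (h.1 k) (h'.1 k), add_mem h.2 h'.2⟩
  zero_mem' := ⟨fun _ => zero_mem _, zero_mem _⟩
  smul_mem' c _ h := ⟨fun k => SMulMemClass.smul_mem c (h.1 k), SMulMemClass.smul_mem c h.2⟩
  mul_mem' h h' := ⟨fun k => mul_mem (h.1 k) (h'.1 k), mul_mem h.2 h'.2⟩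
  star_mem' h := ⟨fun k => star_mem (h.1 k), star_mem h.2⟩

theorem stepMap_mem (hα : Extendible α) (J : ClosedIdeal A) (n : ℕ) {x : Ambient J n}
    (hx : x ∈ stage hα J n) : stepMap α J n x ∈ stage hα J (n + 1) := by
  refine ⟨fun k => ?_, map_mem_corner hα n hx.2⟩
  change (if h : k.1 < n then x.1 ⟨k.1, h⟩ else J.toQuot x.2) ∈ _
  by_cases h : k.1 < n
  · simpa only [h, dite_true] using hx.1 ⟨k.1, h⟩
  · have hk : k.1 = n := by omega
    simp only [hk, lt_irrefl, dite_false]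
    exact ⟨x.2, hx.2, rfl⟩

theorem stageEndo_mem (hα : Extendible α) (J : ClosedIdeal A) (n : ℕ) (x : Ambient J n)
    (hx : x ∈ stage hα J n) : stageEndo α J n x ∈ stage hα J n := by
  have h := stepMap_mem hα J n hx
  refine ⟨fun k => ?_, corner_succ_le hα n h.2⟩
  obtain ⟨a, ha, hak⟩ := h.1 k.succ
  exact ⟨a, corner_succ_le hα k.1 ha, hak⟩

/-- The algebra `B` of the natural reversible `J`-extension of `(A, α)`: the inductive limit of
`B_0 → B_1 → B_2 → ...`. -/
def natSubalgebra (hα : Extendible α) (J : ClosedIdeal A) :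
    NonUnitalStarSubalgebra ℂ (SeqQuot (Ambient J)) :=
  limSubalgebra (stepMap α J) (stage hα J)

/-- The algebra `B` as a type. -/
def NatExt (hα : Extendible α) (J : ClosedIdeal A) : Type u := natSubalgebra hα J

instance (hα : Extendible α) (J : ClosedIdeal A) : NonUnitalCStarAlgebra (NatExt hα J) :=
  NonUnitalStarSubalgebra.nonUnitalCStarAlgebra (natSubalgebra hα J)
    (h_closed := NonUnitalStarSubalgebra.isClosed_topologicalClosure _)

/-- The endomorphism `β` of `B`, induced by the `β_n`. -/
def natEndo (hα : Extendible α) (J : ClosedIdeal A) : NatExt hα J →⋆ₙₐ[ℂ] NatExt hα J :=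
  NonUnitalStarAlgHom.codRestrict
    ((limEndo (stageEndo α J)).comp (NonUnitalStarSubalgebraClass.subtype (natSubalgebra hα J)))
    (natSubalgebra hα J) fun y =>
      limEndo_mem (stepMap α J) (stage hα J) (stageEndo α J) (stepMap_stageEndo α J)
        (stageEndo_mem hα J) y.2

/-- The canonical homomorphism `φ_n : B_n → B`. -/
def stageHom (hα : Extendible α) (J : ClosedIdeal A) (n : ℕ) : stage hα J n →⋆ₙₐ[ℂ] NatExt hα J :=
  NonUnitalStarAlgHom.codRestrict
    ((limMap (stepMap α J) n).comp (NonUnitalStarSubalgebraClass.subtype (stage hα J n)))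
    (natSubalgebra hα J) fun x => limMap_mem (stepMap α J) (stage hα J) x.2

/-- The canonical embedding `A = B_0 → B`. -/
def natEmb (hα : Extendible α) (J : ClosedIdeal A) (a : A) : NatExt hα J :=
  stageHom hα J 0 ⟨(Fin.elim0, a), fun k => k.elim0, a, rfl⟩

end NaturalExtension

end CStarDyn

end

open CStarDyn

/-!
Write `p_k = α̅ᵏ(1)` and `c_k(a) = p_k a p_k`. Every element of `B_n` is the point `pt n s` with
coordinates `q_J(c_0(s_0)), ..., q_J(c_{n-1}(s_{n-1})), c_n(s_n)` of a sequence `s` in `A`, and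
these points are dense in `B`. On points everything is explicit: `β` shifts the sequence to the left
(`natEndo_pt`), `β_*` shifts it to the right (`transfer_pt`), and for the multiplier
`q = 1 - β̅_*(1)` and `a ∈ A`, `q a` is the point of `B_1` with coordinates `q_J(a), 0`
(`mulL_one_sub_natEmb`).

*Extendibility.* By Cohen's factorization theorem (`exists_factorization`), a homomorphism `f` is
extendible as soon as `f(e_i) b` converges for all `b`, for one approximate unit `e_i`
(`extendible_of_tendsto`). For `β` this is checked on points with an approximate unit of `A`, and
for a quotient system it is inherited from the system.

*Reversibility.* A complete transfer operator exists if and only if each `β̅(1) b β̅(1)` is `β(c)`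
for some `c ∈ (ker β)^⊥`; then `β_*(b) = c` is unique, and extendibility of `β_*` follows from the
transfer identities (`isReversible_of_exists`, `IsCompleteTransferOperator.extendible`). Since
`J ∩ ker α = 0`, the maps `B_n → B` are isometric; so the points with vanishing `0`-th coordinate
lie in `(ker β)^⊥`, and the right shift provides the required `c`.

*Ideals.* The invariant ideals of `B` are the ideals invariant under `β` and `β_*`. As an ideal `K`
contains the coordinates of its points, `K ∩ B_n` is given by the stated sum over the pair of `K`
(`inter_range_stageHom`), and `K` is determined by the intersections `K ∩ B_n`
(`ideal_le_of_forall_stage`). So `K ↦ (I, I')` is an order embedding (`pairOf_le_iff`).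
Conversely, a `J`-pair `(I, I')` induces a surjection `natQuotHom` of `B` onto the natural
reversible `q_I(I')`-extension of `(A / I, α_I)`, which intertwines the endomorphisms and the
transfer operators. Its kernel is an invariant ideal whose pair is `(I, I')` (`exists_pairOf_eq`).
This gives surjectivity and the description of the quotient systems at the same time. Finally,
`J`-pairs are closed under entrywise intersections, hence form a (complete) lattice.
-/

noncomputable section

namespace CStarDyn

universe u v w

/-! ### Homomorphisms and quotients -/

section Hom

variable {A : Type u} [NonUnitalCStarAlgebra A] {B : Type v} [NonUnitalCStarAlgebra B]
  {C : Type w} [NonUnitalCStarAlgebra C]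

/-- The homomorphism `A / I → B` induced by a homomorphism `A → B` which vanishes on `I`. -/
def ClosedIdeal.quotLift (f : A →⋆ₙₐ[ℂ] B) (I : ClosedIdeal A) (h : ∀ a ∈ I, f a = 0) :
    I.Quot →⋆ₙₐ[ℂ] B where
  toFun := Quotient.lift f fun a a' haa' => by
    have h1 : a - a' ∈ I := (Submodule.quotientRel_def _).1 haa'
    rw [← sub_eq_zero, ← map_sub]
    exact h _ h1
  map_smul' c x := by
    obtain ⟨a, rfl⟩ := I.toQuot_surjective x
    exact map_smul f c a
  map_zero' := map_zero f
  map_add' x y := by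
    obtain ⟨a, rfl⟩ := I.toQuot_surjective x
    obtain ⟨b, rfl⟩ := I.toQuot_surjective y
    exact map_add f a b
  map_mul' x y := by
    obtain ⟨a, rfl⟩ := I.toQuot_surjective x
    obtain ⟨b, rfl⟩ := I.toQuot_surjective y
    exact map_mul f a b
  map_star' x := by
    obtain ⟨a, rfl⟩ := I.toQuot_surjective x
    exact map_star f a

theorem ClosedIdeal.quotLift_injective (f : A →⋆ₙₐ[ℂ] B) (I : ClosedIdeal A)
    (h : ∀ a ∈ I, f a = 0) (h' : ∀ a, f a = 0 → a ∈ I) :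
    Function.Injective (quotLift f I h) := by
  rw [injective_iff_map_eq_zero]
  intro x hx
  obtain ⟨a, rfl⟩ := I.toQuot_surjective x
  exact toQuot_eq_zero.2 (h' a hx)

theorem ClosedIdeal.continuous_toQuot (I : ClosedIdeal A) : Continuous I.toQuot :=
  I.isQuotientMap_toQuot.continuous

/-- Since `A / ker f` embeds isometrically into the codomain of `f`, the norm of `f a` is that of
`a + ker f`, which decreases when the kernel grows. -/
theorem norm_le_norm_of_ker_le (f : A →⋆ₙₐ[ℂ] B) (g : A →⋆ₙₐ[ℂ] C)
    (h : ∀ a, f a = 0 → g a = 0) (a : A) : ‖g a‖ ≤ ‖f a‖ := by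
  have h1 := NonUnitalStarAlgHom.norm_map (ClosedIdeal.quotLift f (ClosedIdeal.ker f)
    fun _ h => h) (ClosedIdeal.quotLift_injective _ _ _ fun _ h => h)
    ((ClosedIdeal.ker f).toQuot a)
  have h2 := NonUnitalStarAlgHom.norm_apply_le (ClosedIdeal.quotLift g (ClosedIdeal.ker f) h)
    ((ClosedIdeal.ker f).toQuot a)
  exact h2.trans h1.ge

theorem isClosed_range_hom (f : A →⋆ₙₐ[ℂ] B) : IsClosed (Set.range f) := by
  have h1 := (NonUnitalStarAlgHom.isometry (ClosedIdeal.quotLift f (ClosedIdeal.ker f)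
    fun _ h => h) (ClosedIdeal.quotLift_injective _ _ _ fun _ h => h)).isClosedEmbedding
  convert h1.isClosed_range using 1
  ext b
  constructor
  · rintro ⟨a, rfl⟩
    exact ⟨(ClosedIdeal.ker f).toQuot a, rfl⟩
  · rintro ⟨x, rfl⟩
    obtain ⟨a, rfl⟩ := (ClosedIdeal.ker f).toQuot_surjective x
    exact ⟨a, rfl⟩

theorem isClosed_image_hom (f : A →⋆ₙₐ[ℂ] B) (S : NonUnitalStarSubalgebra ℂ A)
    (hS : IsClosed (S : Set A)) : IsClosed (f '' S) := by
  have := hS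
  convert isClosed_range_hom (f.comp (NonUnitalStarSubalgebraClass.subtype S)) using 1
  ext b
  constructor
  · rintro ⟨a, ha, rfl⟩
    exact ⟨⟨a, ha⟩, rfl⟩
  · rintro ⟨x, rfl⟩
    exact ⟨x, x.2, rfl⟩

end Hom

/-! ### Factorization -/

section Factorization

variable {A : Type u} [NonUnitalCStarAlgebra A] {B : Type v} [NonUnitalCStarAlgebra B]
  {ι : Type w} {l : Filter ι} {e : ι → A}

/-- The family `e`, along the filter `l`, is a contractive self-adjoint approximate unit. -/
structure IsApproxUnitAlong (l : Filter ι) (e : ι → A) : Prop where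
  neBot : l.NeBot
  norm_le : ∀ᶠ i in l, ‖e i‖ ≤ 1
  isSelfAdjoint : ∀ᶠ i in l, IsSelfAdjoint (e i)
  tendsto_mul : ∀ a, Tendsto (fun i => e i * a) l (𝓝 a)

theorem IsApproxUnitAlong.tendsto_mul' (h : IsApproxUnitAlong l e) (a : A) :
    Tendsto (fun i => a * e i) l (𝓝 a) := by
  have h1 := (continuous_star.tendsto (star a)).comp (h.tendsto_mul (star a))
  rw [star_star] at h1
  refine h1.congr' ?_
  filter_upwards [h.isSelfAdjoint] with i hi
  simp [hi.star_eq]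

theorem exists_isApproxUnitAlong (A : Type u) [NonUnitalCStarAlgebra A] :
    ∃ l : Filter A, IsApproxUnitAlong l (fun a : A => a) := by
  obtain ⟨l, hl, h1⟩ := exists_approxUnit A
  exact ⟨l, hl.neBot, h1.mono fun e he => he.2.2, h1.mono fun e he => he.1, hl.tendsto_mul_right⟩

/-- One step of the factorization, in the unitizations: `u z = y` is replaced by
`u' z' = y` where `z' = (2 - e) z` and `u' = u (2 - e)⁻¹`, for a member `e` of the approximate
unit. -/
theorem factor_step (f : A →⋆ₙₐ[ℂ] B) (h : IsApproxUnitAlong l e) {y : B} {δ : ℝ} (hδ : 0 < δ)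
    {u : Unitization ℂ A} {z : B} (hu : u.fst = δ)
    (huz : Unitization.starMap f u * (z : Unitization ℂ B) = y)
    (hz : Tendsto (fun i => f (e i) * z) l (𝓝 z)) :
    ∃ (u' : Unitization ℂ A) (z' : B), u'.fst = (δ / 2 : ℝ) ∧
      Unitization.starMap f u' * (z' : Unitization ℂ B) = y ∧
      Tendsto (fun i => f (e i) * z') l (𝓝 z') ∧ dist z z' ≤ δ ∧ dist u u' ≤ 3 * δ := by
  have := h.neBot
  obtain ⟨i, hi1, hi2, hi3⟩ := (h.norm_le.and (((Metric.tendsto_nhds.1 hz) δ hδ).and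
    ((Metric.tendsto_nhds.1 (h.tendsto_mul' u.snd)) δ hδ))).exists
  set E : Unitization ℂ A := (e i : Unitization ℂ A) with hE
  have hEn : ‖E‖ ≤ 1 := by rw [hE, Unitization.norm_inr]; exact hi1
  have hlt : ‖(2⁻¹ : ℂ) • E‖ < 1 := by
    rw [norm_smul]; norm_num; linarith
  set w : (Unitization ℂ A)ˣ := Units.oneSub _ hlt with hw
  have hwv : (w : Unitization ℂ A) = 1 - (2⁻¹ : ℂ) • E := rfl
  set v : Unitization ℂ A := (2⁻¹ : ℂ) • (↑w⁻¹ : Unitization ℂ A) with hv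
  have h2w : (2 : ℂ) • (w : Unitization ℂ A) = 2 - E := by
    rw [hwv, smul_sub, smul_smul, two_smul, one_add_one_eq_two]
    norm_num
  have hv1 : v * (2 - E) = 1 := by
    rw [← h2w, hv, smul_mul_smul_comm, Units.inv_mul]; norm_num
  have hv2 : (2 - E) * v = 1 := by
    rw [← h2w, hv, smul_mul_smul_comm, Units.mul_inv]; norm_num
  -- `2 v = 1 + e v`, so `2 ‖v‖ ≤ 1 + ‖v‖`
  have hvn : ‖v‖ ≤ 1 := by
    have h3 : (2 : ℂ) • v = 1 + E * v := by
      rw [two_smul, ← hv2]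
      noncomm_ring
    have h4 : ‖(2 : ℂ) • v‖ ≤ 1 + 1 * ‖v‖ := by
      rw [h3]
      refine (norm_add_le _ _).trans (add_le_add norm_one.le ((norm_mul_le _ _).trans ?_))
      gcongr
    rw [norm_smul] at h4
    norm_num at h4
    linarith
  have hvf : v.fst = (2⁻¹ : ℂ) := by
    have := congrArg (Unitization.fstHom ℂ A) hv1
    rw [map_mul, map_sub, map_ofNat, map_one, hE, Unitization.fstHom_apply,
      Unitization.fstHom_apply, Unitization.fst_inr, sub_zero] at this
    linear_combination (1 / 2 : ℂ) * this
  have hmap : Unitization.starMap f (2 - E) * (z : Unitization ℂ B)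
      = ((2 : ℂ) • z - f (e i) * z : B) := by
    rw [map_sub, hE, Unitization.starMap_inr, sub_mul, map_ofNat]
    simp [two_smul, two_mul]
  refine ⟨u * v, (2 : ℂ) • z - f (e i) * z, ?_, ?_, ?_, ?_, ?_⟩
  · rw [Unitization.fst_mul, hu, hvf]; push_cast; ring
  · rw [← hmap, ← mul_assoc, ← map_mul, mul_assoc, hv1, mul_one, huz]
  · have h1 := h.tendsto_mul (e i)
    have h2 : Tendsto (fun j => f (e j * e i) * z) l (𝓝 (f (e i) * z)) :=
      (((ClosedIdeal.continuous_hom f).tendsto _).comp h1).mul_const z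
    refine ((hz.const_smul (2 : ℂ)).sub h2).congr fun j => ?_
    rw [map_mul, mul_sub, mul_smul_comm, mul_assoc]
  · rw [dist_eq_norm, two_smul, show z - (z + z - f (e i) * z) = f (e i) * z - z by abel,
      ← dist_eq_norm]
    exact hi2.le
  · have h3 : u - u * v = (u - u * E) * v := by
      have : u - u * v = u * ((2 - E) * v) - u * v := by rw [hv2, mul_one]
      rw [this]; noncomm_ring
    have h4 : u - u * E = (δ : ℂ) • (1 - E) + ((u.snd - u.snd * e i : A) : Unitization ℂ A) := by
      conv_lhs => rw [← Unitization.inl_fst_add_inr_snd_eq u, hu]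
      rw [show (Unitization.inl (δ : ℂ) : Unitization ℂ A) = (δ : ℂ) • 1 by
        ext <;> simp]
      rw [hE, add_mul, smul_mul_assoc, one_mul, smul_sub, ← Unitization.inr_mul,
        Unitization.inr_sub]
      abel
    rw [dist_eq_norm, h3]
    have h5 : ‖u - u * E‖ ≤ 3 * δ := by
      rw [h4]
      refine (norm_add_le _ _).trans ?_
      rw [norm_smul, Unitization.norm_inr]
      rw [dist_comm, dist_eq_norm] at hi3
      have h6 : ‖(1 : Unitization ℂ A) - E‖ ≤ 2 :=
        (norm_sub_le _ _).trans (by rw [norm_one]; linarith)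
      have h7 : ‖(δ : ℂ)‖ = δ := by simp [abs_of_pos hδ]
      rw [h7]
      nlinarith
    calc _ ≤ ‖u - u * E‖ * ‖v‖ := norm_mul_le _ _
      _ ≤ (3 * δ) * 1 := by gcongr
      _ = _ := mul_one _

/-- Cohen's factorization theorem for the module `B` over `A` given by a homomorphism `f`:
an element which is fixed in the limit by an approximate unit is of the form `f a * c`. -/
theorem exists_factorization (f : A →⋆ₙₐ[ℂ] B) (h : IsApproxUnitAlong l e) {y : B}
    (hy : Tendsto (fun i => f (e i) * y) l (𝓝 y)) : ∃ (a : A) (c : B), y = f a * c := by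
  -- along the iteration, `u_n z_n = y` where `u_n` has scalar part `2⁻ⁿ`; in the limit the scalar
  -- part vanishes and `u ∈ A`
  let Inv : ℕ → Unitization ℂ A × B → Prop := fun n p => p.1.fst = ((2 : ℝ)⁻¹ ^ n : ℝ) ∧
    Unitization.starMap f p.1 * (p.2 : Unitization ℂ B) = y ∧
    Tendsto (fun i => f (e i) * p.2) l (𝓝 p.2)
  have step : ∀ n (s : {p // Inv n p}), ∃ s' : {p // Inv (n + 1) p},
      dist s.1.2 s'.1.2 ≤ 2⁻¹ ^ n ∧ dist s.1.1 s'.1.1 ≤ 3 * 2⁻¹ ^ n := by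
    rintro n ⟨⟨u, z⟩, h1, h2, h3⟩
    obtain ⟨u', z', h4, h5, h6, h7, h8⟩ := factor_step f h (by positivity) h1 h2 h3
    refine ⟨⟨(u', z'), ?_, h5, h6⟩, h7, h8⟩
    change u'.fst = _
    rw [h4, pow_succ]; rfl
  choose next hnext using step
  let S : ∀ n, {p // Inv n p} := fun n => Nat.rec ⟨(1, y), by simp [Inv, hy]⟩ next n
  have hS1 : ∀ n, dist (S n).1.2 (S (n + 1)).1.2 ≤ 2⁻¹ ^ n := fun n => (hnext n (S n)).1
  have hS2 : ∀ n, dist (S n).1.1 (S (n + 1)).1.1 ≤ 3 * 2⁻¹ ^ n := fun n => (hnext n (S n)).2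
  have hsum : Summable fun n : ℕ => (2⁻¹ : ℝ) ^ n :=
    summable_geometric_of_lt_one (by norm_num) (by norm_num)
  obtain ⟨c, hc⟩ := cauchySeq_tendsto_of_complete
    (cauchySeq_of_dist_le_of_summable _ hS1 hsum)
  obtain ⟨u, hu⟩ := cauchySeq_tendsto_of_complete
    (cauchySeq_of_dist_le_of_summable _ hS2 (hsum.mul_left 3))
  have hu0 : u.fst = 0 := by
    have h1 : Tendsto (fun n => (S n).1.1.fst) atTop (𝓝 u.fst) :=
      (Unitization.continuous_fst.tendsto u).comp hu
    have h2 : Tendsto (fun n => (S n).1.1.fst) atTop (𝓝 0) := by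
      have : (fun n => (S n).1.1.fst) = fun n => (((2 : ℝ)⁻¹ ^ n : ℝ) : ℂ) :=
        funext fun n => (S n).2.1
      rw [this]
      have h3 := tendsto_pow_atTop_nhds_zero_of_lt_one (r := (2⁻¹ : ℝ)) (by norm_num)
        (by norm_num)
      exact_mod_cast (Complex.continuous_ofReal.tendsto 0).comp h3
    exact tendsto_nhds_unique h1 h2
  refine ⟨u.snd, c, ?_⟩
  have h1 : Tendsto (fun n => Unitization.starMap f (S n).1.1 * ((S n).1.2 : Unitization ℂ B))
      atTop (𝓝 (Unitization.starMap f u * (c : Unitization ℂ B))) := by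
    refine Tendsto.mul ?_ ?_
    · exact ((map_continuous (Unitization.starMap f)).tendsto u).comp hu
    · exact ((Unitization.isometry_inr (𝕜 := ℂ) (A := B)).continuous.tendsto c).comp hc
  have h2 : Unitization.starMap f u * (c : Unitization ℂ B) = y :=
    tendsto_nhds_unique h1 (tendsto_const_nhds.congr fun n => (S n).2.2.1.symm)
  have h3 : u = (u.snd : Unitization ℂ A) := by ext <;> simp [hu0]
  rw [h3, Unitization.starMap_inr, ← Unitization.inr_mul] at h2
  exact (Unitization.inr_injective h2).symm

end Factorization

/-! ### Extendible homomorphisms -/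

section Extension

variable {A : Type u} [NonUnitalCStarAlgebra A] {B : Type v} [NonUnitalCStarAlgebra B]
  {ι : Type w} {l : Filter ι} {e : ι → A}

theorem continuous_mulL (m : 𝓜(ℂ, A)) : Continuous (mulL m) := m.fst.continuous

theorem continuous_mulR (m : 𝓜(ℂ, A)) : Continuous fun a => mulR a m := m.snd.continuous

theorem continuous_compress (m : 𝓜(ℂ, A)) : Continuous (compress m) :=
  (continuous_mulL m).comp (continuous_mulR m)

theorem star_mulL (m : 𝓜(ℂ, A)) (a : A) : star (mulL m a) = mulR (star a) (star m) :=
  toMul_injective (by rw [toMul_star, toMul_mulL, toMul_mulR, star_mul, toMul_star])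

theorem star_mulR (m : 𝓜(ℂ, A)) (a : A) : star (mulR a m) = mulL (star m) (star a) :=
  toMul_injective (by rw [toMul_star, toMul_mulL, toMul_mulR, star_mul, toMul_star])

theorem mulR_mul (m : 𝓜(ℂ, A)) (a b : A) : mulR (a * b) m = a * mulR b m :=
  toMul_injective (by rw [toMul_mulR, toMul_mul, toMul_mul, toMul_mulR, mul_assoc])

theorem strict_continuous_mulL (a : A) :
    Continuous[strictTopology A, inferInstance] fun m : 𝓜(ℂ, A) => mulL m a := by
  let := strictTopology A
  have h : Continuous fun m : 𝓜(ℂ, A) => ((fun a => mulL m a, fun a => mulL (star m) a) :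
    (A → A) × (A → A)) := continuous_induced_dom
  exact (continuous_apply a).comp (continuous_fst.comp h)

theorem strict_continuous_mulL_star (a : A) :
    Continuous[strictTopology A, inferInstance] fun m : 𝓜(ℂ, A) => mulL (star m) a := by
  let := strictTopology A
  have h : Continuous fun m : 𝓜(ℂ, A) => ((fun a => mulL m a, fun a => mulL (star m) a) :
    (A → A) × (A → A)) := continuous_induced_dom
  exact (continuous_apply a).comp (continuous_snd.comp h)

theorem continuous_strict_of {X : Type*} [TopologicalSpace X] {E : X → 𝓜(ℂ, B)}
    (h1 : ∀ b, Continuous fun m => mulL (E m) b)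
    (h2 : ∀ b, Continuous fun m => mulL (star (E m)) b) :
    Continuous[_, strictTopology B] E :=
  continuous_induced_rng.2 ((continuous_pi h1).prodMk (continuous_pi h2))

/-- By strict density of `A` in `M(A)`, a strictly continuous extension is determined by the
given map. -/
theorem ext_eq_of_isStrictExtension {T : A → B} (h : Extendible T) {E : 𝓜(ℂ, A) → 𝓜(ℂ, B)}
    (hE : IsStrictExtension T E) : h.ext = E := by
  funext m
  obtain ⟨l, f, hl, hf⟩ := exists_strict_approx m
  have h1 := strict_ext_tendsto h hf
  have h2 := strict_ext_tendsto ⟨E, hE⟩ hf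
  have h3 := (@Continuous.tendsto _ _ (strictTopology A) (strictTopology B) _
    hE.continuous m).comp hf
  refine strict_unique h1 (h3.congr fun i => ?_)
  change E (toMul (f i)) = h.ext (toMul (f i))
  rw [hE.extends_map, h.ext_spec.extends_map]

theorem IsApproxUnitAlong.tendsto_strict (h : IsApproxUnitAlong l e) :
    Tendsto (fun i => toMul (e i)) l (@nhds _ (strictTopology A) 1) := by
  rw [tendsto_strict_iff]
  refine ⟨h.tendsto_mul, fun a => ?_⟩
  rw [star_one]
  refine (h.tendsto_mul a).congr' ?_
  filter_upwards [h.isSelfAdjoint] with i hi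
  rw [← toMul_star, hi.star_eq, mulL_toMul]

/-- A homomorphism `f` is extendible as soon as `f e_i * b` converges for every `b`, for some
approximate unit `e_i`. By factorization, the limit is of the form `f a * c`, and the extension
maps `m` to the multiplier `b ↦ f (m a) * c`. -/
theorem extendible_of_tendsto (f : A →⋆ₙₐ[ℂ] B) (h : IsApproxUnitAlong l e)
    (hf : ∀ b, ∃ y, Tendsto (fun i => f (e i) * b) l (𝓝 y)) : Extendible f := by
  have := h.neBot
  have hfc := ClosedIdeal.continuous_hom f
  choose P hP using hf
  have hP1 : ∀ a b, f a * P b = f a * b := fun a b => by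
    refine tendsto_nhds_unique ((hP b).const_mul (f a)) ?_
    refine (((hfc.tendsto _).comp (h.tendsto_mul' a)).mul_const b).congr fun i => ?_
    rw [Function.comp, map_mul, mul_assoc]
  have hfac : ∀ b, ∃ (a : A) (c : B), P b = f a * c := fun b =>
    exists_factorization f h ((hP b).congr fun i => (hP1 _ _).symm)
  choose a c hac using hfac
  -- the formula for `F` depends on choices, but `F m b` is the limit of `f (m e_i) * b` and of
  -- `f (e_i m) * b`, which makes it linear in `b`, bounded, and compatible with the adjoint
  let F : 𝓜(ℂ, A) → B → B := fun m b => f (mulL m (a b)) * c b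
  have hF0 : ∀ x m b, f (mulR x m) * b = f x * F m b := fun x m b => by
    rw [← hP1, hac, ← mul_assoc, ← map_mul, mulR_mul_eq, map_mul, mul_assoc]
  have hF1 : ∀ m b, Tendsto (fun i => f (mulL m (e i)) * b) l (𝓝 (F m b)) := fun m b => by
    have h1 := ((((continuous_mulL m).tendsto _).comp (h.tendsto_mul (a b))))
    refine (((hfc.tendsto _).comp h1).mul_const (c b)).congr fun i => ?_
    simp only [Function.comp]
    rw [mulL_mul_right, map_mul, mul_assoc, ← hac, hP1]
  have hF2 : ∀ m b, Tendsto (fun i => f (mulR (e i) m) * b) l (𝓝 (F m b)) := fun m b => by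
    refine (((hfc.tendsto _).comp (h.tendsto_mul (mulL m (a b)))).mul_const (c b)).congr fun i => ?_
    rw [hF0]
    simp only [F, Function.comp]
    rw [map_mul, mul_assoc]
  have hFs : ∀ m b, Tendsto (fun i => b * f (mulL m (e i))) l
      (𝓝 (star (F (star m) (star b)))) := fun m b => by
    refine ((continuous_star.tendsto _).comp (hF2 (star m) (star b))).congr' ?_
    filter_upwards [h.isSelfAdjoint] with i hi
    simp only [Function.comp]
    rw [star_mul, star_star, ← map_star, star_mulR, star_star, hi.star_eq]
  have hFn : ∀ m b, ‖F m b‖ ≤ ‖m‖ * ‖b‖ := fun m b => by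
    refine le_of_tendsto (hF1 m b).norm ?_
    filter_upwards [h.norm_le] with i hi
    calc _ ≤ ‖f (mulL m (e i))‖ * ‖b‖ := norm_mul_le _ _
      _ ≤ ‖mulL m (e i)‖ * ‖b‖ := by gcongr; exact NonUnitalStarAlgHom.norm_apply_le f _
      _ ≤ ‖m‖ * ‖b‖ := by
        gcongr
        calc _ ≤ ‖m.fst‖ * ‖e i‖ := m.fst.le_opNorm _
          _ ≤ ‖m‖ * 1 := by rw [DoubleCentralizer.norm_fst]; gcongr
          _ = ‖m‖ := mul_one _
  have hFadd : ∀ m b b', F m (b + b') = F m b + F m b' := fun m b b' =>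
    tendsto_nhds_unique (hF1 m _) (((hF1 m b).add (hF1 m b')).congr fun i => (mul_add _ _ _).symm)
  have hFsmul : ∀ m (r : ℂ) b, F m (r • b) = r • F m b := fun m r b =>
    tendsto_nhds_unique (hF1 m _) (((hF1 m b).const_smul r).congr fun i =>
      (mul_smul_comm r _ _).symm)
  let FL : 𝓜(ℂ, A) → B →L[ℂ] B := fun m =>
    LinearMap.mkContinuous ⟨⟨F m, hFadd m⟩, hFsmul m⟩ ‖m‖ (hFn m)
  let FR : 𝓜(ℂ, A) → B →L[ℂ] B := fun m =>
    LinearMap.mkContinuous ⟨⟨fun b => star (F (star m) (star b)), fun b b' => by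
      rw [star_add, hFadd, star_add]⟩, fun r b => by
      change star (F (star m) (star (r • b))) = r • star (F (star m) (star b))
      rw [star_smul, hFsmul, star_smul, star_star]⟩ ‖star m‖ fun b => by
      change ‖star (F (star m) (star b))‖ ≤ _
      rw [norm_star]
      exact (hFn _ _).trans (by rw [norm_star b])
  let E : 𝓜(ℂ, A) → 𝓜(ℂ, B) := fun m => ⟨(FL m, FR m), fun x y =>
    tendsto_nhds_unique ((hFs m x).mul_const y)
      (((hF1 m y).const_mul x).congr fun i => (mul_assoc _ _ _).symm)⟩
  have hE : ∀ m b, mulL (E m) b = f (mulL m (a b)) * c b := fun _ _ => rfl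
  have hEs : ∀ m b, mulL (star (E m)) b = f (mulL (star m) (a b)) * c b := fun m b => by
    change star (star (F (star m) (star (star b)))) = _
    rw [star_star, star_star]
  refine ⟨E, ?_, fun x => mul_ext fun b => ?_⟩
  · let := strictTopology A
    refine continuous_strict_of (fun b => ?_) (fun b => ?_)
    · simp only [hE]
      exact (hfc.comp (strict_continuous_mulL (a b))).mul continuous_const
    · simp only [hEs]
      exact (hfc.comp (strict_continuous_mulL_star (a b))).mul continuous_const
  · rw [hE, mulL_toMul, mulL_toMul, map_mul, mul_assoc, ← hac, hP1]

theorem tendsto_ext_one {f : A →⋆ₙₐ[ℂ] B} (hf : Extendible f) (h : IsApproxUnitAlong l e)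
    (b : B) : Tendsto (fun i => f (e i) * b) l (𝓝 (mulL (hf.ext 1) b)) := by
  refine ((tendsto_strict_iff.1 (strict_ext_tendsto hf h.tendsto_strict)).1 b).congr fun i => ?_
  rw [ext_toMul, mulL_toMul]

theorem star_ext_one {f : A →⋆ₙₐ[ℂ] B} (hf : Extendible f) : star (hf.ext 1) = hf.ext 1 := by
  rw [← ext_star, star_one]

theorem ext_one_mul_self {f : A →⋆ₙₐ[ℂ] B} (hf : Extendible f) :
    hf.ext 1 * hf.ext 1 = hf.ext 1 := by
  rw [← ext_mul, one_mul]

theorem tendsto_ext_one' {f : A →⋆ₙₐ[ℂ] B} (hf : Extendible f) (h : IsApproxUnitAlong l e)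
    (b : B) : Tendsto (fun i => b * f (e i)) l (𝓝 (mulR b (hf.ext 1))) := by
  have h1 := (continuous_star.tendsto _).comp (tendsto_ext_one hf h (star b))
  rw [star_mulL, star_star, star_ext_one] at h1
  refine h1.congr' ?_
  filter_upwards [h.isSelfAdjoint] with i hi
  simp only [Function.comp]
  rw [star_mul, star_star, ← map_star, hi.star_eq]

theorem ext_one_mul_toMul {f : A →⋆ₙₐ[ℂ] B} (hf : Extendible f) (a : A) :
    hf.ext 1 * toMul (f a) = toMul (f a) := by
  rw [← ext_toMul hf, ← ext_mul, one_mul]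

theorem toMul_mul_ext_one {f : A →⋆ₙₐ[ℂ] B} (hf : Extendible f) (a : A) :
    toMul (f a) * hf.ext 1 = toMul (f a) := by
  rw [← ext_toMul hf, ← ext_mul, mul_one]

theorem compress_ext_one_map_mul {f : A →⋆ₙₐ[ℂ] B} (hf : Extendible f) (a : A) (b : B) :
    compress (hf.ext 1) (f a * b) = f a * compress (hf.ext 1) b := by
  apply toMul_injective
  simp only [toMul_compress, toMul_mul]
  rw [← mul_assoc, ext_one_mul_toMul, ← mul_assoc, ← mul_assoc, toMul_mul_ext_one]

theorem compress_ext_one_mul_map {f : A →⋆ₙₐ[ℂ] B} (hf : Extendible f) (a : A) (b : B) :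
    compress (hf.ext 1) (b * f a) = compress (hf.ext 1) b * f a := by
  apply toMul_injective
  simp only [toMul_compress, toMul_mul]
  rw [mul_assoc, mul_assoc, toMul_mul_ext_one, mul_assoc, mul_assoc, ext_one_mul_toMul]

theorem compress_ext_one_map {f : A →⋆ₙₐ[ℂ] B} (hf : Extendible f) (a : A) :
    compress (hf.ext 1) (f a) = f a := by
  apply toMul_injective
  rw [toMul_compress, ext_one_mul_toMul, toMul_mul_ext_one]

theorem star_compress {m : 𝓜(ℂ, A)} (hm : star m = m) (a : A) :
    star (compress m a) = compress m (star a) := by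
  apply toMul_injective
  simp only [toMul_compress, toMul_star, star_mul, hm, mul_assoc]

theorem compress_add (m : 𝓜(ℂ, A)) (a b : A) :
    compress m (a + b) = compress m a + compress m b := by simp [compress, mulL, mulR]

theorem compress_smul (m : 𝓜(ℂ, A)) (r : ℂ) (a : A) : compress m (r • a) = r • compress m a := by
  simp [compress, mulL, mulR]

theorem norm_compress_le (m : 𝓜(ℂ, A)) (a : A) : ‖compress m a‖ ≤ ‖m‖ * (‖m‖ * ‖a‖) :=
  calc _ ≤ ‖m.fst‖ * ‖m.snd a‖ := m.fst.le_opNorm _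
    _ ≤ ‖m.fst‖ * (‖m.snd‖ * ‖a‖) := by gcongr; exact m.snd.le_opNorm _
    _ = _ := by rw [DoubleCentralizer.norm_fst, DoubleCentralizer.norm_snd]

end Extension

/-! ### Complete transfer operators -/

section Transfer

variable {B : Type u} [NonUnitalCStarAlgebra B] {β : B →⋆ₙₐ[ℂ] B}

theorem eq_zero_of_mem_annihilator_of_mem {I : ClosedIdeal B} {c : B} (h : c ∈ I.annihilator)
    (h' : c ∈ I) : c = 0 :=
  CStarRing.mul_star_self_eq_zero_iff c |>.1 (h _ (I.star_mem h'))

theorem mem_annihilator_of_forall_mul_eq_zero {I : ClosedIdeal B} {c : B}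
    (h : ∀ x ∈ I, x * c = 0) : c ∈ I.annihilator := fun x hx => by
  rw [← CStarRing.star_mul_self_eq_zero_iff, ← mul_assoc, h _ (I.star_mem (I.mul_mem_left _ hx)),
    zero_mul]

theorem eq_of_mem_annihilator_ker {b c : B} (hb : b ∈ (ClosedIdeal.ker β).annihilator)
    (hc : c ∈ (ClosedIdeal.ker β).annihilator) (h : β b = β c) : b = c := by
  rw [← sub_eq_zero]
  refine eq_zero_of_mem_annihilator_of_mem (I := ClosedIdeal.ker β) (sub_mem hb hc) ?_
  change β (b - c) = 0
  rw [map_sub, h, sub_self]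

/-- The restriction of `β` to the `C*`-algebra `(ker β)^⊥` is injective, hence isometric. -/
theorem norm_map_of_mem_annihilator_ker {b : B} (hb : b ∈ (ClosedIdeal.ker β).annihilator) :
    ‖β b‖ = ‖b‖ := by
  set N := (ClosedIdeal.ker β).annihilator
  have : IsClosed (N.toStarSubalgebra : Set B) := N.isClosed
  refine NonUnitalStarAlgHom.norm_map (β.comp (NonUnitalStarSubalgebraClass.subtype
    N.toStarSubalgebra)) ?_ ⟨b, hb⟩
  rintro ⟨x, hx⟩ ⟨y, hy⟩ hxy
  exact Subtype.ext (eq_of_mem_annihilator_ker hx hy hxy)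

/-- A system `(B, β)` is reversible if each element of the corner `β̅(1) B β̅(1)` is the image of
an element of `(ker β)^⊥`, which is then unique. -/
theorem isReversible_of_exists (hβ : Extendible β)
    (h : ∀ b, ∃ c ∈ (ClosedIdeal.ker β).annihilator, β c = compress (hβ.ext 1) b) :
    IsReversible β hβ := by
  choose L hL1 hL2 using h
  have key : ∀ b c, c ∈ (ClosedIdeal.ker β).annihilator → β c = compress (hβ.ext 1) b →
      L b = c := fun b c h1 h2 => eq_of_mem_annihilator_ker (hL1 b) h1 ((hL2 b).trans h2.symm)
  refine ⟨⟨⟨L, fun a b => key _ _ (add_mem (hL1 a) (hL1 b)) ?_⟩, fun r a =>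
    key _ _ (ClosedIdeal.smul_mem _ r (hL1 a)) ?_⟩, ⟨fun a => ?_, fun a b => ?_⟩, hL2⟩
  · rw [map_add, hL2, hL2, compress_add]
  · rw [map_smul, hL2, compress_smul]; rfl
  · -- the square root of `p a* a p`, where `p = β̅(1)`, again lies in the corner
    let := CStarAlgebra.spectralOrder B
    have := CStarAlgebra.spectralOrderedRing B
    set p := hβ.ext 1 with hp
    set y := mulR a p with hy
    have hyy : star y * y = compress p (star a * a) := by
      apply toMul_injective
      rw [toMul_compress, toMul_mul, toMul_star, hy, toMul_mulR, star_mul, hp, star_ext_one,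
        toMul_mul, toMul_star]
      simp only [mul_assoc]
    have h0 : 0 ≤ star y * y := star_mul_self_nonneg y
    set s := CFC.sqrt (star y * y) with hs
    have hs1 : s * s = star y * y := CFC.sqrt_mul_sqrt_self _ h0
    have hs2 : star s = s := (IsSelfAdjoint.of_nonneg (CFC.sqrt_nonneg _)).star_eq
    have hs3 : mulR s p = s := by
      refine eq_of_mul_right fun b => ?_
      rw [mulR_mul_eq, ← sub_eq_zero, ← mul_sub, ← CStarRing.star_mul_self_eq_zero_iff, star_mul,
        hs2, mul_assoc, ← mul_assoc s, hs1, mul_assoc (star y), mul_sub, ← mulR_mul_eq,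
        hy]
      have : mulR (mulR a p) p = mulR a p := toMul_injective (by
        rw [toMul_mulR, toMul_mulR, mul_assoc, ext_one_mul_self])
      rw [this, sub_self, mul_zero, mul_zero]
    have hs4 : compress p s = s := by
      rw [compress, hs3]
      have := congrArg star hs3
      rwa [star_mulR, hs2, star_ext_one] at this
    refine ⟨L s, key _ _ (ClosedIdeal.mul_mem_left _ _ (hL1 s)) ?_⟩
    rw [map_mul, map_star, hL2, hs4, hs2, hs1, hyy]
  · refine key _ _ (ClosedIdeal.mul_mem_left _ _ (hL1 b)) ?_
    rw [map_mul, compress_ext_one_map_mul, ← hL2]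
    rfl

variable {hβ : Extendible β} {L : B →ₗ[ℂ] B}

theorem IsCompleteTransferOperator.mem_annihilator (hL : IsCompleteTransferOperator β hβ L)
    (b : B) : L b ∈ (ClosedIdeal.ker β).annihilator :=
  mem_annihilator_of_forall_mul_eq_zero fun x (hx : β x = 0) => by
    rw [← hL.transfer, hx, zero_mul, map_zero]

/-- `β_*(b)` is the unique element of `(ker β)^⊥` which `β` maps to `β̅(1) b β̅(1)`. -/
theorem IsCompleteTransferOperator.eq_of (hL : IsCompleteTransferOperator β hβ L) {b c : B}
    (hc : c ∈ (ClosedIdeal.ker β).annihilator) (h : β c = compress (hβ.ext 1) b) : L b = c :=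
  eq_of_mem_annihilator_ker (hL.mem_annihilator b) hc ((hL.complete b).trans h.symm)

theorem IsCompleteTransferOperator.apply_star (hL : IsCompleteTransferOperator β hβ L) (b : B) :
    L (star b) = star (L b) :=
  hL.eq_of (ClosedIdeal.star_mem _ (hL.mem_annihilator b)) <| by
    rw [map_star, hL.complete, ← star_compress (star_ext_one hβ)]; rfl

theorem IsCompleteTransferOperator.transfer' (hL : IsCompleteTransferOperator β hβ L) (a b : B) :
    L (b * β a) = L b * a :=
  hL.eq_of (ClosedIdeal.mul_mem_right _ _ (hL.mem_annihilator b)) <| by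
    rw [map_mul, hL.complete, compress_ext_one_mul_map]; rfl

theorem IsCompleteTransferOperator.continuous (hL : IsCompleteTransferOperator β hβ L) :
    Continuous L :=
  AddMonoidHomClass.continuous_of_bound L (‖hβ.ext 1‖ * ‖hβ.ext 1‖) fun b => by
    rw [← norm_map_of_mem_annihilator_ker (hL.mem_annihilator b), hL.complete, mul_assoc]
    exact norm_compress_le _ _

/-- The map `b ↦ β_*(β(b))` restricts to the identity on `(ker β)^⊥`. -/
theorem IsCompleteTransferOperator.apply_map (hL : IsCompleteTransferOperator β hβ L) {b : B}
    (hb : b ∈ (ClosedIdeal.ker β).annihilator) : L (β b) = b :=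
  hL.eq_of hb (compress_ext_one_map hβ b).symm

/-- The strict extension of `β_*` maps a multiplier `m` to the multiplier `b ↦ β_*(m β(b))`. -/
theorem IsCompleteTransferOperator.exists_isStrictExtension
    (hL : IsCompleteTransferOperator β hβ L) :
    ∃ E, IsStrictExtension L E ∧ ∀ m b, mulL (E m) b = L (mulL m (β b)) := by
  let LC : B →L[ℂ] B := ⟨L, hL.continuous⟩
  let βC : B →L[ℂ] B := ⟨⟨⟨β, map_add β⟩, map_smul β⟩, ClosedIdeal.continuous_hom β⟩
  let E : 𝓜(ℂ, B) → 𝓜(ℂ, B) := fun m =>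
    ⟨(LC.comp (m.fst.comp βC), LC.comp (m.snd.comp βC)), fun x y => by
      change L (mulR (β x) m) * y = x * L (mulL m (β y))
      rw [← hL.transfer, ← hL.transfer', mulR_mul_eq]⟩
  have hE : ∀ m b, mulL (E m) b = L (mulL m (β b)) := fun _ _ => rfl
  have hEs : ∀ m b, mulL (star (E m)) b = L (mulL (star m) (β b)) := fun m b => by
    change star (L (mulR (β (star b)) m)) = _
    rw [← hL.apply_star, star_mulR, ← map_star, star_star]
  refine ⟨E, ⟨?_, fun x => mul_ext fun b => ?_⟩, hE⟩
  · let := strictTopology B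
    refine continuous_strict_of (fun b => ?_) (fun b => ?_)
    · simp only [hE]
      exact hL.continuous.comp (strict_continuous_mulL (β b))
    · simp only [hEs]
      exact hL.continuous.comp (strict_continuous_mulL_star (β b))
  · rw [hE, mulL_toMul, mulL_toMul, hL.transfer']

theorem IsCompleteTransferOperator.extendible (hL : IsCompleteTransferOperator β hβ L) :
    Extendible L :=
  let ⟨E, hE, _⟩ := hL.exists_isStrictExtension
  ⟨E, hE⟩

theorem IsCompleteTransferOperator.mulL_one_sub (hL : IsCompleteTransferOperator β hβ L)
    (hL' : Extendible L) (b : B) : mulL (1 - hL'.ext 1) b = b - L (β b) := by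
  obtain ⟨E, hE, h⟩ := hL.exists_isStrictExtension
  rw [ext_eq_of_isStrictExtension hL' hE]
  change b - mulL (E 1) b = _
  rw [h, mulL_one]

/-- An invariant ideal is invariant under the transfer operator, since `β(β_*(b)) = β̅(1) b β̅(1)`
and `β_*(b) ∈ (ker β)^⊥`. -/
theorem IsCompleteTransferOperator.map_mem (hL : IsCompleteTransferOperator β hβ L)
    (K : InvariantIdeal β) {b : B} (hb : b ∈ K.ideal) : L b ∈ K.ideal := by
  refine K.negative _ (hL.mem_annihilator b) ?_
  rw [hL.complete]
  -- for a multiplier `p`, the element `p b p` is a limit of elements `p e_i b e_i p` of `K`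
  obtain ⟨l, hl⟩ := exists_isApproxUnitAlong B
  have := hl.neBot
  have h1 : Tendsto (fun e => mulL (hβ.ext 1) e * mulR b (hβ.ext 1)) l
      (𝓝 (mulL (hβ.ext 1) (mulR b (hβ.ext 1)))) :=
    (((continuous_mulL _).tendsto _).comp (hl.tendsto_mul (mulR b (hβ.ext 1)))).congr fun e =>
      mulL_mul_right _ _ _
  refine K.ideal.isClosed.mem_of_tendsto h1 (Eventually.of_forall fun e => ?_)
  refine K.ideal.mul_mem_left _ ?_
  have h2 : Tendsto (fun e => b * mulR e (hβ.ext 1)) l (𝓝 (mulR b (hβ.ext 1))) :=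
    (((continuous_mulR _).tendsto _).comp (hl.tendsto_mul' b)).congr fun e => mulR_mul _ _ _
  exact K.ideal.isClosed.mem_of_tendsto h2 (Eventually.of_forall fun e =>
    K.ideal.mul_mem_right _ hb)

/-- An ideal which is mapped into itself by both `β` and `β_*` is an invariant ideal. -/
def InvariantIdeal.ofTransfer (hL : IsCompleteTransferOperator β hβ L) (K : ClosedIdeal B)
    (h1 : ∀ b ∈ K, β b ∈ K) (h2 : ∀ b ∈ K, L b ∈ K) : InvariantIdeal β where
  ideal := K
  positive := h1
  negative b hb h := by
    rw [← hL.apply_map hb]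
    exact h2 _ h

end Transfer

/-! ### Inductive limits of sequences -/

section LimitMaps

variable {X : ℕ → Type u} [∀ n, NonUnitalCStarAlgebra (X n)]
  {Y : ℕ → Type u} [∀ n, NonUnitalCStarAlgebra (Y n)]

theorem transition_self (T : ∀ n, X n →⋆ₙₐ[ℂ] X (n + 1)) (n : ℕ) (x : X n) :
    transition T le_rfl x = x := by
  unfold transition
  rw [Nat.leRecOn_self]
  rfl

theorem transition_succ (T : ∀ n, X n →⋆ₙₐ[ℂ] X (n + 1)) {n m : ℕ} (h : n ≤ m)
    (h' : n ≤ m + 1) (x : X n) : transition T h' x = T m (transition T h x) := by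
  unfold transition
  rw [Nat.leRecOn_succ h]
  rfl

theorem transition_step (T : ∀ n, X n →⋆ₙₐ[ℂ] X (n + 1)) {n m : ℕ} (h : n + 1 ≤ m)
    (h' : n ≤ m) (x : X n) : transition T h (T n x) = transition T h' x := by
  induction m, h using Nat.le_induction with
  | base => rw [transition_self, transition_succ T le_rfl, transition_self]
  | succ m h ih =>
    rw [transition_succ T h, transition_succ T (Nat.le_of_succ_le h), ih]

theorem norm_transition {T : ∀ n, X n →⋆ₙₐ[ℂ] X (n + 1)} (hT : ∀ n, Function.Injective (T n))
    {n m : ℕ} (h : n ≤ m) (x : X n) : ‖transition T h x‖ = ‖x‖ := by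
  induction m, h using Nat.le_induction with
  | base => rw [transition_self]
  | succ m h ih => rw [transition_succ T h, NonUnitalStarAlgHom.norm_map (T m) (hT m), ih]

theorem mem_nullIdeal_of_eventually_eq_zero {s : lp X ∞} (h : ∀ᶠ n in atTop, s n = 0) :
    s ∈ nullIdeal X :=
  tendsto_const_nhds.congr' (h.mono fun _ hn => (norm_eq_zero.2 hn).symm)

theorem limMap_step (T : ∀ n, X n →⋆ₙₐ[ℂ] X (n + 1)) (n : ℕ) (x : X n) :
    limMap T (n + 1) (T n x) = limMap T n x := by
  refine ClosedIdeal.toQuot_eq_iff.2 (mem_nullIdeal_of_eventually_eq_zero ?_)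
  filter_upwards [eventually_ge_atTop (n + 1)] with m hm
  change (if h : n + 1 ≤ m then transition T h else 0 : X (n + 1) →⋆ₙₐ[ℂ] X m) (T n x)
    - (if h : n ≤ m then transition T h else 0 : X n →⋆ₙₐ[ℂ] X m) x = 0
  rw [dif_pos hm, dif_pos (Nat.le_of_succ_le hm), transition_step T hm (Nat.le_of_succ_le hm),
    sub_self]

/-- If the bonding maps are injective, hence isometric, then so are the canonical maps into the
limit. -/
theorem norm_limMap {T : ∀ n, X n →⋆ₙₐ[ℂ] X (n + 1)} (hT : ∀ n, Function.Injective (T n))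
    (n : ℕ) (x : X n) : ‖limMap T n x‖ = ‖x‖ := by
  refine le_antisymm (NonUnitalStarAlgHom.norm_apply_le _ _) ?_
  refine le_of_forall_pos_le_add fun ε hε => ?_
  obtain ⟨s, hs, hsn⟩ := (nullIdeal X).exists_norm_lt (limMap T n x) hε
  have h1 : Tendsto (fun m => ‖(s - seqHom (fun m => if h : n ≤ m then transition T h else 0) x :
      lp X ∞) m‖) atTop (𝓝 0) := ClosedIdeal.toQuot_eq_iff.1 hs
  refine le_trans ?_ hsn.le
  have h2 : Tendsto (fun m => ‖(s - seqHom (fun m => if h : n ≤ m then transition T h else 0) x :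
      lp X ∞) m‖ + ‖s‖) atTop (𝓝 ‖s‖) := by simpa using h1.add_const ‖s‖
  refine ge_of_tendsto h2 ?_
  filter_upwards [eventually_ge_atTop n] with m hm
  have h3 : (s - seqHom (fun m => if h : n ≤ m then transition T h else 0) x : lp X ∞) m
      = s m - transition T hm x := by
    change s m - (if h : n ≤ m then transition T h else 0 : X n →⋆ₙₐ[ℂ] X m) x = _
    rw [dif_pos hm]
  rw [h3, ← norm_transition hT hm x]
  have h4 : ‖s m‖ ≤ ‖s‖ := lp.norm_apply_le_norm ENNReal.top_ne_zero s m
  have h5 := norm_sub_norm_le (transition T hm x) (s m)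
  rw [norm_sub_rev] at h5
  linarith

/-- The homomorphism of limits induced by homomorphisms `f n : X n → Y n`. -/
def limHom (f : ∀ n, X n →⋆ₙₐ[ℂ] Y n) : SeqQuot X →⋆ₙₐ[ℂ] SeqQuot Y :=
  ClosedIdeal.quotMap (seqHom fun n => (f n).comp (evalHom X n)) _ _ fun s hs =>
    squeeze_zero (fun _ => norm_nonneg _)
      (fun n => NonUnitalStarAlgHom.norm_apply_le (f n) (s n)) hs

theorem limHom_limMap {T : ∀ n, X n →⋆ₙₐ[ℂ] X (n + 1)} {T' : ∀ n, Y n →⋆ₙₐ[ℂ] Y (n + 1)}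
    {f : ∀ n, X n →⋆ₙₐ[ℂ] Y n} (hf : ∀ n x, T' n (f n x) = f (n + 1) (T n x)) (n : ℕ) (x : X n) :
    limHom f (limMap T n x) = limMap T' n (f n x) := by
  have key : ∀ m (h : n ≤ m), f m (transition T h x) = transition T' h (f n x) := fun m h => by
    induction m, h using Nat.le_induction with
    | base => rw [transition_self, transition_self]
    | succ m h ih => rw [transition_succ T h, transition_succ T' h, ← ih, hf]
  refine congrArg (nullIdeal Y).toQuot (lp.ext (funext fun m => ?_))
  change f m ((if h : n ≤ m then transition T h else 0 : X n →⋆ₙₐ[ℂ] X m) x)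
    = (if h : n ≤ m then transition T' h else 0 : Y n →⋆ₙₐ[ℂ] Y m) (f n x)
  by_cases h : n ≤ m
  · simp only [h, dite_true, key]
  · simp [h]

/-- The subalgebras whose supremum defines the limit are increasing, so the supremum is a union. -/
theorem mem_closure_of_mem_limSubalgebra {T : ∀ n, X n →⋆ₙₐ[ℂ] X (n + 1)}
    {S : ∀ n, NonUnitalStarSubalgebra ℂ (X n)} (hS : ∀ n, ∀ x ∈ S n, T n x ∈ S (n + 1))
    {y : SeqQuot X} (hy : y ∈ limSubalgebra T S) :
    y ∈ closure (⋃ n, limMap T n '' (S n)) := by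
  have hmono : Monotone fun n => (S n).map (limMap T n) := monotone_nat_of_le_succ fun n => by
    rintro _ ⟨x, hx, rfl⟩
    exact ⟨T n x, hS n x hx, limMap_step T n x⟩
  have h1 := NonUnitalStarSubalgebra.coe_iSup_of_directed hmono.directed_le
  change y ∈ closure ((⨆ n, (S n).map (limMap T n) : NonUnitalStarSubalgebra ℂ (SeqQuot X)) :
    Set (SeqQuot X)) at hy
  rw [h1] at hy
  exact hy

end LimitMaps

/-! ### Convergence on a dense set -/

section Dense

variable {B : Type u} [NonUnitalCStarAlgebra B] {ι : Type w} {l : Filter ι} {g : ι → B}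

/-- For contractions `g i`, the graph of the partially defined map `b ↦ lim g i * b` is closed. -/
theorem isClosed_setOf_tendsto_mul (hg : ∀ᶠ i in l, ‖g i‖ ≤ 1) :
    IsClosed {p : B × B | Tendsto (fun i => g i * p.1) l (𝓝 p.2)} := by
  refine isClosed_of_closure_subset fun p hp => Metric.tendsto_nhds.2 fun ε hε => ?_
  obtain ⟨q, hq, hpq⟩ := Metric.mem_closure_iff.1 hp (ε / 3) (by positivity)
  filter_upwards [hg, Metric.tendsto_nhds.1 hq (ε / 3) (by positivity)] with i hi1 hi2
  rw [Prod.dist_eq, max_lt_iff] at hpq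
  have h1 : dist (g i * p.1) (g i * q.1) ≤ dist p.1 q.1 := by
    rw [dist_eq_norm, dist_eq_norm, ← mul_sub]
    calc _ ≤ ‖g i‖ * ‖p.1 - q.1‖ := norm_mul_le _ _
      _ ≤ 1 * ‖p.1 - q.1‖ := by gcongr
      _ = _ := one_mul _
  have h2 := dist_triangle4 (g i * p.1) (g i * q.1) q.2 p.2
  rw [dist_comm q.2] at h2
  linarith [hpq.1, hpq.2]

theorem tendsto_mul_of_mem_closure (hg : ∀ᶠ i in l, ‖g i‖ ≤ 1) {D : Set B}
    (hD : ∀ d ∈ D, Tendsto (fun i => g i * d) l (𝓝 d)) {b : B} (hb : b ∈ closure D) :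
    Tendsto (fun i => g i * b) l (𝓝 b) := by
  have h1 : IsClosed {b : B | Tendsto (fun i => g i * b) l (𝓝 b)} :=
    (isClosed_setOf_tendsto_mul hg).preimage (continuous_id.prodMk continuous_id)
  exact closure_minimal hD h1 hb

theorem exists_tendsto_mul_of_mem_closure [l.NeBot] (hg : ∀ᶠ i in l, ‖g i‖ ≤ 1) {D : Set B}
    (hD : ∀ d ∈ D, ∃ y, Tendsto (fun i => g i * d) l (𝓝 y)) {b : B} (hb : b ∈ closure D) :
    ∃ y, Tendsto (fun i => g i * b) l (𝓝 y) := by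
  obtain ⟨d, hd, hdb⟩ := mem_closure_iff_seq_limit.1 hb
  choose y hy using fun n => hD (d n) (hd n)
  have hc : CauchySeq y := by
    refine Metric.cauchySeq_iff.2 fun ε hε => ?_
    obtain ⟨N, hN⟩ := Metric.cauchySeq_iff.1 hdb.cauchySeq ε hε
    refine ⟨N, fun m hm n hn => lt_of_le_of_lt ?_ (hN m hm n hn)⟩
    rw [dist_eq_norm, dist_eq_norm]
    refine le_of_tendsto ((hy m).sub (hy n)).norm ?_
    filter_upwards [hg] with i hi
    rw [← mul_sub]
    calc _ ≤ ‖g i‖ * ‖d m - d n‖ := norm_mul_le _ _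
      _ ≤ 1 * ‖d m - d n‖ := by gcongr
      _ = _ := one_mul _
  obtain ⟨z, hz⟩ := cauchySeq_tendsto_of_complete hc
  exact ⟨z, (isClosed_setOf_tendsto_mul hg).mem_of_tendsto (hdb.prodMk_nhds hz)
    (Eventually.of_forall hy)⟩

end Dense

/-! ### Coordinates in the natural reversible extension -/

section Points

variable {A : Type u} [NonUnitalCStarAlgebra A] {α : A →⋆ₙₐ[ℂ] A} (hα : Extendible α)

theorem cornerUnit_mul_of_le {j k : ℕ} (h : j ≤ k) :
    cornerUnit hα j * cornerUnit hα k = cornerUnit hα k := by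
  induction k, h using Nat.le_induction with
  | base => exact cornerUnit_mul_self hα j
  | succ k h ih => rw [← cornerUnit_mul_succ hα k, ← mul_assoc, ih]

theorem cornerUnit_mul_of_le' {j k : ℕ} (h : j ≤ k) :
    cornerUnit hα k * cornerUnit hα j = cornerUnit hα k := by
  have := congrArg star (cornerUnit_mul_of_le hα h)
  rwa [star_mul, star_cornerUnit, star_cornerUnit] at this

theorem compress_one (a : A) : compress (1 : 𝓜(ℂ, A)) a = a := rfl

theorem compress_mulL {p : 𝓜(ℂ, A)} (h : p * p = p) (a : A) :
    compress p (mulL p a) = compress p a := by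
  apply toMul_injective
  rw [toMul_compress, toMul_compress, toMul_mulL, ← mul_assoc, h]

theorem compress_compress {p r : 𝓜(ℂ, A)} (h : p * r = r) (h' : r * p = r) (a : A) :
    compress p (compress r a) = compress r a := by
  apply toMul_injective
  simp only [toMul_compress]
  rw [mul_assoc, mul_assoc, mul_assoc, h', ← mul_assoc p, h, mul_assoc]

theorem compress_cornerUnit_of_le {j k : ℕ} (h : j ≤ k) (a : A) :
    compress (cornerUnit hα j) (compress (cornerUnit hα k) a) = compress (cornerUnit hα k) a :=
  compress_compress (cornerUnit_mul_of_le hα h) (cornerUnit_mul_of_le' hα h) a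

theorem map_compress_cornerUnit (k : ℕ) (a : A) :
    α (compress (cornerUnit hα k) a) = compress (cornerUnit hα (k + 1)) (α a) := by
  apply toMul_injective
  rw [← ext_toMul hα, toMul_compress, toMul_compress, ext_mul, ext_mul, ext_toMul, cornerUnit_succ]

theorem cornerUnit_mul_iterate (k : ℕ) (a : A) :
    cornerUnit hα k * toMul (α^[k] a) = toMul (α^[k] a) := by
  induction k with
  | zero => exact one_mul _
  | succ k ih =>
    rw [Function.iterate_succ_apply', ← ext_toMul hα, cornerUnit_succ, ← ext_mul, ih]

theorem iterate_mul_cornerUnit (k : ℕ) (a : A) :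
    toMul (α^[k] a) * cornerUnit hα k = toMul (α^[k] a) := by
  induction k with
  | zero => exact mul_one _
  | succ k ih =>
    rw [Function.iterate_succ_apply', ← ext_toMul hα, cornerUnit_succ, ← ext_mul, ih]

theorem compress_cornerUnit_iterate (k : ℕ) (a : A) :
    compress (cornerUnit hα k) (α^[k] a) = α^[k] a := by
  apply toMul_injective
  rw [toMul_compress, cornerUnit_mul_iterate, iterate_mul_cornerUnit]

theorem compress_iterate_mul (k : ℕ) (a b : A) :
    α^[k] a * compress (cornerUnit hα k) b = compress (cornerUnit hα k) (α^[k] a * b) := by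
  apply toMul_injective
  simp only [toMul_compress, toMul_mul]
  rw [← mul_assoc (cornerUnit hα k) (toMul _), cornerUnit_mul_iterate, ← mul_assoc, ← mul_assoc,
    iterate_mul_cornerUnit]

theorem compress_mul_iterate (k : ℕ) (a b : A) :
    compress (cornerUnit hα k) b * α^[k] a = compress (cornerUnit hα k) (b * α^[k] a) := by
  apply toMul_injective
  simp only [toMul_compress, toMul_mul]
  rw [mul_assoc, cornerUnit_mul_iterate, mul_assoc _ _ (cornerUnit hα k), mul_assoc (toMul b),
    iterate_mul_cornerUnit, mul_assoc]

/-- For an approximate unit `e_i`, the net `αᵏ(e_i)` converges strictly to `α̅ᵏ(1)`. -/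
theorem tendsto_iterate_strict {ι : Type w} {l : Filter ι} {e : ι → A}
    (h : IsApproxUnitAlong l e) (k : ℕ) :
    Tendsto (fun i => toMul (α^[k] (e i))) l (@nhds _ (strictTopology A) (cornerUnit hα k)) := by
  induction k with
  | zero => exact h.tendsto_strict
  | succ k ih =>
    refine (cornerUnit_succ hα k ▸ strict_ext_tendsto hα ih).congr fun i => ?_
    rw [ext_toMul, Function.iterate_succ_apply']

theorem tendsto_iterate_mul {ι : Type w} {l : Filter ι} {e : ι → A}
    (h : IsApproxUnitAlong l e) (k : ℕ) (a : A) :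
    Tendsto (fun i => α^[k] (e i) * a) l (𝓝 (mulL (cornerUnit hα k) a)) :=
  (tendsto_strict_iff.1 (tendsto_iterate_strict hα h k)).1 a

theorem tendsto_mul_iterate {ι : Type w} {l : Filter ι} {e : ι → A}
    (h : IsApproxUnitAlong l e) (k : ℕ) (a : A) :
    Tendsto (fun i => a * α^[k] (e i)) l (𝓝 (mulR a (cornerUnit hα k))) := by
  have h1 := (continuous_star.tendsto _).comp
    ((tendsto_strict_iff.1 (tendsto_iterate_strict hα h k)).2 (star a))
  rw [star_mulL, star_star, star_star] at h1
  refine h1.congr fun i => ?_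
  simp only [Function.comp]
  rw [← toMul_star, mulL_toMul, star_mul, star_star, star_star]

variable (J : ClosedIdeal A)

/-- The element `(q_J(p_0 s_0 p_0), ..., q_J(p_{n-1} s_{n-1} p_{n-1}), p_n s_n p_n)` of `B_n`, where
`p_k = α̅ᵏ(1)`, as an element of `(A / J)ⁿ ⊕ A`. -/
def ptAmbient (n : ℕ) (s : ℕ → A) : Ambient J n :=
  (fun k => J.toQuot (compress (cornerUnit hα k) (s k)), compress (cornerUnit hα n) (s n))

theorem ptAmbient_mem (n : ℕ) (s : ℕ → A) : ptAmbient hα J n s ∈ stage hα J n :=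
  ⟨fun k => ⟨_, ⟨s k, rfl⟩, rfl⟩, ⟨s n, rfl⟩⟩

/-- The image in `B` of the element
`(q_J(p_0 s_0 p_0), ..., q_J(p_{n-1} s_{n-1} p_{n-1}), p_n s_n p_n)` of `B_n`, where `p_k = α̅ᵏ(1)`.
All sequences `s` are allowed and every element of `B_n` is of this form. -/
def pt (n : ℕ) (s : ℕ → A) : NatExt hα J :=
  stageHom hα J n ⟨ptAmbient hα J n s, ptAmbient_mem hα J n s⟩

variable {hα J}

theorem exists_ptAmbient {n : ℕ} {x : Ambient J n} (hx : x ∈ stage hα J n) :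
    ∃ s, x = ptAmbient hα J n s := by
  obtain ⟨h1, b, hb⟩ := hx
  have h2 : ∀ k : Fin n, ∃ a, J.toQuot (compress (cornerUnit hα k) a) = x.1 k := fun k => by
    obtain ⟨_, ⟨a, rfl⟩, ha⟩ := h1 k
    exact ⟨a, ha⟩
  choose a ha using h2
  refine ⟨fun k => if h : k < n then a ⟨k, h⟩ else b, Prod.ext (funext fun k => ?_) ?_⟩
  · simp [ptAmbient, ha]
  · simp [ptAmbient, hb]

theorem range_stageHom (n : ℕ) : Set.range (stageHom hα J n) = Set.range (pt hα J n) := by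
  ext b
  constructor
  · rintro ⟨⟨x, hx⟩, rfl⟩
    obtain ⟨s, rfl⟩ := exists_ptAmbient hx
    exact ⟨s, rfl⟩
  · rintro ⟨s, rfl⟩
    exact ⟨_, rfl⟩

theorem pt_eq_of {n : ℕ} {s t : ℕ → A} (h : ptAmbient hα J n s = ptAmbient hα J n t) :
    pt hα J n s = pt hα J n t :=
  congrArg (stageHom hα J n) (Subtype.ext h)

theorem pt_congr {n : ℕ} {s t : ℕ → A} (h : ∀ k ≤ n, compress (cornerUnit hα k) (s k)
    = compress (cornerUnit hα k) (t k)) : pt hα J n s = pt hα J n t :=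
  pt_eq_of (Prod.ext (funext fun k => congrArg J.toQuot (h k k.2.le)) (h n le_rfl))

theorem stepMap_ptAmbient (n : ℕ) (s : ℕ → A) : stepMap α J n (ptAmbient hα J n s)
    = ptAmbient hα J (n + 1) (Function.update s (n + 1) (α (s n))) := by
  refine Prod.ext (funext fun k => ?_) ?_
  · change (if h : k.1 < n then J.toQuot (compress (cornerUnit hα k) (s k))
      else J.toQuot (compress (cornerUnit hα n) (s n))) = J.toQuot (compress (cornerUnit hα k) _)
    rw [Function.update_of_ne (by omega)]
    split_ifs with h
    · rfl
    · have : k.1 = n := by omega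
      rw [this]
  · change α (compress (cornerUnit hα n) (s n)) = compress (cornerUnit hα (n + 1)) _
    rw [Function.update_self, map_compress_cornerUnit]

/-- The same element of `B` is represented at stage `n` and at stage `n + 1`, where the value of `s`
at `n + 1` has to be `α(s_n)`. -/
theorem pt_succ (n : ℕ) (s : ℕ → A) :
    pt hα J n s = pt hα J (n + 1) (Function.update s (n + 1) (α (s n))) :=
  Subtype.ext <| by
    change limMap (stepMap α J) n (ptAmbient hα J n s) = limMap (stepMap α J) (n + 1)
      (ptAmbient hα J (n + 1) _)
    rw [← stepMap_ptAmbient, limMap_step]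

theorem exists_pt_of_le {n m : ℕ} (h : n ≤ m) (s : ℕ → A) : ∃ t, pt hα J n s = pt hα J m t := by
  induction m, h using Nat.le_induction with
  | base => exact ⟨s, rfl⟩
  | succ m h ih =>
    obtain ⟨t, ht⟩ := ih
    exact ⟨_, ht.trans (pt_succ m t)⟩

theorem pt_add (n : ℕ) (s t : ℕ → A) : pt hα J n (s + t) = pt hα J n s + pt hα J n t := by
  rw [pt, pt, pt, ← map_add]
  refine congrArg (stageHom hα J n) (Subtype.ext (Prod.ext (funext fun k => ?_) ?_))
  · exact congrArg J.toQuot (compress_add _ _ _)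
  · exact compress_add _ _ _

theorem ptAmbient_mul (n : ℕ) (s t : ℕ → A) : ptAmbient hα J n s * ptAmbient hα J n t
    = ptAmbient hα J n fun k =>
      compress (cornerUnit hα k) (s k) * compress (cornerUnit hα k) (t k) := by
  have key : ∀ k (a b : A), compress (cornerUnit hα k) a * compress (cornerUnit hα k) b
      = compress (cornerUnit hα k) (compress (cornerUnit hα k) a * compress (cornerUnit hα k) b) :=
    fun k a b => by
      obtain ⟨c, hc⟩ : compress (cornerUnit hα k) a * compress (cornerUnit hα k) b ∈ corner hα k :=
        mul_mem ⟨a, rfl⟩ ⟨b, rfl⟩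
      rw [← hc, compress_cornerUnit_of_le hα le_rfl]
  exact Prod.ext (funext fun k => congrArg J.toQuot (key _ _ _)) (key _ _ _)

theorem pt_mul (n : ℕ) (s t : ℕ → A) : pt hα J n s * pt hα J n t
    = pt hα J n fun k => compress (cornerUnit hα k) (s k) * compress (cornerUnit hα k) (t k) := by
  rw [pt, pt, pt, ← map_mul]
  exact congrArg (stageHom hα J n) (Subtype.ext (ptAmbient_mul n s t))

theorem pt_star (n : ℕ) (s : ℕ → A) : star (pt hα J n s) = pt hα J n fun k => star (s k) := by
  rw [pt, pt, ← map_star]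
  refine congrArg (stageHom hα J n) (Subtype.ext (Prod.ext (funext fun k => ?_) ?_))
  · exact congrArg J.toQuot (star_compress (star_cornerUnit hα _) _)
  · exact star_compress (star_cornerUnit hα _) _

theorem continuous_pt (n : ℕ) : Continuous (pt hα J n) := by
  refine Continuous.subtype_mk ((ClosedIdeal.continuous_hom (limMap (stepMap α J) n)).comp
    (Continuous.prodMk (continuous_pi fun k => ?_) ?_)) _
  · exact J.continuous_toQuot.comp ((continuous_compress _).comp (continuous_apply _))
  · exact (continuous_compress _).comp (continuous_apply _)

/-- The element `a ∈ A` has the coordinates `a, α(a), α²(a), ...`. -/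
theorem natEmb_eq (a : A) (n : ℕ) : natEmb hα J a = pt hα J n fun k => α^[k] a := by
  induction n with
  | zero => exact congrArg (stageHom hα J 0) (Subtype.ext (Prod.ext (funext fun k => k.elim0) rfl))
  | succ n ih =>
    rw [ih, pt_succ]
    congr 1
    funext k
    by_cases h : k = n + 1
    · subst h; rw [Function.update_self, Function.iterate_succ_apply']
    · rw [Function.update_of_ne h]

/-- The canonical embedding `A → B` as a homomorphism. -/
def natEmbHom (hα : Extendible α) (J : ClosedIdeal A) : A →⋆ₙₐ[ℂ] NatExt hα J where
  toFun := natEmb hα J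
  map_smul' c a := by
    change _ = c • natEmb hα J a
    rw [natEmb, natEmb, ← map_smul]
    exact congrArg (stageHom hα J 0) (Subtype.ext (Prod.ext (funext fun k => k.elim0) rfl))
  map_zero' := by
    rw [natEmb, ← map_zero (stageHom hα J 0)]
    exact congrArg (stageHom hα J 0) (Subtype.ext (Prod.ext (funext fun k => k.elim0) rfl))
  map_add' a b := by
    rw [natEmb, natEmb, natEmb, ← map_add]
    exact congrArg (stageHom hα J 0) (Subtype.ext (Prod.ext (funext fun k => k.elim0) rfl))
  map_mul' a b := by
    rw [natEmb, natEmb, natEmb, ← map_mul]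
    exact congrArg (stageHom hα J 0) (Subtype.ext (Prod.ext (funext fun k => k.elim0) rfl))
  map_star' a := by
    rw [natEmb, natEmb, ← map_star]
    exact congrArg (stageHom hα J 0) (Subtype.ext (Prod.ext (funext fun k => k.elim0) rfl))

theorem natEmbHom_apply (a : A) : natEmbHom hα J a = natEmb hα J a := rfl

theorem natEmb_mul_pt (a : A) (n : ℕ) (s : ℕ → A) :
    natEmb hα J a * pt hα J n s = pt hα J n fun k => α^[k] a * s k := by
  rw [natEmb_eq a n, pt_mul]
  refine pt_congr fun k _ => ?_
  rw [compress_cornerUnit_iterate, compress_iterate_mul, compress_cornerUnit_of_le hα le_rfl]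

theorem pt_mul_natEmb (a : A) (n : ℕ) (s : ℕ → A) :
    pt hα J n s * natEmb hα J a = pt hα J n fun k => s k * α^[k] a := by
  rw [natEmb_eq a n, pt_mul]
  refine pt_congr fun k _ => ?_
  rw [compress_cornerUnit_iterate, compress_mul_iterate, compress_cornerUnit_of_le hα le_rfl]

theorem shiftMap_ptAmbient (n : ℕ) (s : ℕ → A) : shiftMap J n (ptAmbient hα J (n + 1) s)
    = ptAmbient hα J n fun k => compress (cornerUnit hα (k + 1)) (s (k + 1)) :=
  Prod.ext (funext fun _ => congrArg J.toQuot
    (compress_cornerUnit_of_le hα (Nat.le_succ _) _).symm)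
    (compress_cornerUnit_of_le hα (Nat.le_succ _) _).symm

theorem stageEndo_succ (n : ℕ) (x : Ambient J (n + 1)) :
    stageEndo α J (n + 1) x = stepMap α J n (shiftMap J n x) := by
  refine Prod.ext (funext fun k => ?_) rfl
  simp only [stageEndo, stepMap, shiftMap, NonUnitalStarAlgHom.comp_apply,
    NonUnitalStarAlgHom.coe_mk', NonUnitalAlgHom.coe_mk]
  by_cases h : k.1 < n <;> simp [h]

/-- The endomorphism of the natural extension is the left shift. The stage `n + 1` is used to
represent the argument so that the coordinates of the image come from the given ones. -/
theorem natEndo_pt (n : ℕ) (s : ℕ → A) : natEndo hα J (pt hα J (n + 1) s)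
    = pt hα J n fun k => compress (cornerUnit hα (k + 1)) (s (k + 1)) :=
  Subtype.ext <| by
    change limEndo (stageEndo α J) (limMap (stepMap α J) (n + 1) (ptAmbient hα J (n + 1) s))
      = limMap (stepMap α J) n (ptAmbient hα J n fun k =>
        compress (cornerUnit hα (k + 1)) (s (k + 1)))
    rw [limEndo_limMap _ _ (stepMap_stageEndo α J), ← shiftMap_ptAmbient, stageEndo_succ,
      limMap_step]

theorem natEndo_natEmb (a : A) : natEndo hα J (natEmb hα J a) = natEmb hα J (α a) := by
  rw [natEmb_eq a 1, natEndo_pt, natEmb_eq _ 0]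
  refine pt_congr fun k _ => ?_
  rw [compress_cornerUnit_iterate, Function.iterate_succ_apply]

theorem mem_closure_iUnion_pt (b : NatExt hα J) : b ∈ closure (⋃ n, Set.range (pt hα J n)) := by
  have h1 := mem_closure_of_mem_limSubalgebra (fun n x hx => stepMap_mem hα J n hx) b.2
  rw [Metric.mem_closure_iff] at h1 ⊢
  intro ε hε
  obtain ⟨y, hy, hby⟩ := h1 ε hε
  obtain ⟨n, hn⟩ := Set.mem_iUnion.1 hy
  obtain ⟨x, hx, rfl⟩ := hn
  obtain ⟨s, rfl⟩ := exists_ptAmbient hx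
  exact ⟨pt hα J n s, Set.mem_iUnion.2 ⟨n, s, rfl⟩, hby⟩

/-- A closed property of elements of `B` has to be checked on points of the stages only. -/
theorem natExt_induction {p : NatExt hα J → Prop} (hp : IsClosed {b | p b})
    (h : ∀ n s, p (pt hα J n s)) (b : NatExt hα J) : p b :=
  closure_minimal (Set.iUnion_subset fun n => Set.range_subset_iff.2 (h n)) hp
    (mem_closure_iUnion_pt b)

/-! ### Extendibility and reversibility of the extension -/

theorem isApproxUnitAlong_natEmb {ι : Type w} {l : Filter ι} {e : ι → A}
    (h : IsApproxUnitAlong l e) : IsApproxUnitAlong l fun i => natEmb hα J (e i) where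
  neBot := h.neBot
  norm_le := h.norm_le.mono fun i hi =>
    (NonUnitalStarAlgHom.norm_apply_le (natEmbHom hα J) (e i)).trans hi
  isSelfAdjoint := h.isSelfAdjoint.mono fun i hi => by
    rw [← natEmbHom_apply]; exact hi.map _
  tendsto_mul b := by
    refine tendsto_mul_of_mem_closure (h.norm_le.mono fun i hi =>
      (NonUnitalStarAlgHom.norm_apply_le (natEmbHom hα J) (e i)).trans hi) ?_
      (mem_closure_iUnion_pt b)
    intro d hd
    obtain ⟨n, s, rfl⟩ := Set.mem_iUnion.1 hd
    simp only [natEmbHom_apply, natEmb_mul_pt]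
    have h1 := ((continuous_pt (hα := hα) (J := J) n).tendsto _).comp
      (tendsto_pi_nhds.2 fun k => tendsto_iterate_mul hα h k (s k))
    have h2 : pt hα J n s = pt hα J n fun k => mulL (cornerUnit hα k) (s k) :=
      pt_congr fun k _ => (compress_mulL (cornerUnit_mul_self hα k) _).symm
    rw [h2]
    exact h1

/-- Multiplication by `β̅(1)` from the left acts on the `k`-th coordinate as multiplication by
`α̅ᵏ⁺¹(1)`. -/
theorem tendsto_natEndo_natEmb_mul_pt {ι : Type w} {l : Filter ι} {e : ι → A}
    (h : IsApproxUnitAlong l e) (n : ℕ) (s : ℕ → A) :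
    Tendsto (fun i => natEndo hα J (natEmb hα J (e i)) * pt hα J n s) l
      (𝓝 (pt hα J n fun k => mulL (cornerUnit hα (k + 1)) (s k))) := by
  simp only [natEndo_natEmb, natEmb_mul_pt, ← Function.iterate_succ_apply]
  exact ((continuous_pt (hα := hα) (J := J) n).tendsto _).comp
    (tendsto_pi_nhds.2 fun k => tendsto_iterate_mul hα h (k + 1) (s k))

theorem tendsto_pt_mul_natEndo_natEmb {ι : Type w} {l : Filter ι} {e : ι → A}
    (h : IsApproxUnitAlong l e) (n : ℕ) (s : ℕ → A) :
    Tendsto (fun i => pt hα J n s * natEndo hα J (natEmb hα J (e i))) l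
      (𝓝 (pt hα J n fun k => mulR (s k) (cornerUnit hα (k + 1)))) := by
  simp only [natEndo_natEmb, pt_mul_natEmb, ← Function.iterate_succ_apply]
  exact ((continuous_pt (hα := hα) (J := J) n).tendsto _).comp
    (tendsto_pi_nhds.2 fun k => tendsto_mul_iterate hα h (k + 1) (s k))

/-- The image under `A → B` of an approximate unit of `A` is an approximate unit of `B`, and on
each stage `B_n` its image under `β` converges strictly. -/
theorem extendible_natEndo : Extendible (natEndo hα J) := by
  obtain ⟨l, hl⟩ := exists_isApproxUnitAlong A
  have := hl.neBot
  refine extendible_of_tendsto _ (isApproxUnitAlong_natEmb hl) fun b => ?_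
  refine exists_tendsto_mul_of_mem_closure ?_ ?_ (mem_closure_iUnion_pt b)
  · exact hl.norm_le.mono fun i hi => (NonUnitalStarAlgHom.norm_apply_le _ _).trans
      ((NonUnitalStarAlgHom.norm_apply_le (natEmbHom hα J) i).trans hi)
  · intro d hd
    obtain ⟨n, s, rfl⟩ := Set.mem_iUnion.1 hd
    exact ⟨_, tendsto_natEndo_natEmb_mul_pt hl n s⟩

/-- The compression by `β̅(1)` acts on the `k`-th coordinate as the compression by `α̅ᵏ⁺¹(1)`. -/
theorem compress_natEndo_ext_one (hβ : Extendible (natEndo hα J)) (n : ℕ) (s : ℕ → A) :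
    compress (hβ.ext 1) (pt hα J n s)
      = pt hα J n fun k => compress (cornerUnit hα (k + 1)) (s k) := by
  obtain ⟨l, hl⟩ := exists_isApproxUnitAlong A
  have := hl.neBot
  have h1 : ∀ s, mulL (hβ.ext 1) (pt hα J n s)
      = pt hα J n fun k => mulL (cornerUnit hα (k + 1)) (s k) := fun s =>
    tendsto_nhds_unique (tendsto_ext_one hβ (isApproxUnitAlong_natEmb hl) _)
      (tendsto_natEndo_natEmb_mul_pt hl n s)
  have h2 : mulR (pt hα J n s) (hβ.ext 1)
      = pt hα J n fun k => mulR (s k) (cornerUnit hα (k + 1)) :=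
    tendsto_nhds_unique (tendsto_ext_one' hβ (isApproxUnitAlong_natEmb hl) _)
      (tendsto_pt_mul_natEndo_natEmb hl n s)
  rw [compress, h2, h1]
  rfl

/-- The sequence `0, s_0, s_1, ...`. -/
def delay (s : ℕ → A) : ℕ → A
  | 0 => 0
  | k + 1 => s k

theorem natEndo_pt_delay (n : ℕ) (s : ℕ → A) : natEndo hα J (pt hα J (n + 1) (delay s))
    = pt hα J n fun k => compress (cornerUnit hα (k + 1)) (s k) :=
  natEndo_pt n (delay s)

theorem exists_pt_delay_of_le {n m : ℕ} (h : n ≤ m) (s : ℕ → A) :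
    ∃ t, pt hα J (n + 1) (delay s) = pt hα J (m + 1) (delay t) := by
  induction m, h using Nat.le_induction with
  | base => exact ⟨s, rfl⟩
  | succ m h ih =>
    obtain ⟨t, ht⟩ := ih
    refine ⟨Function.update t (m + 1) (α (t m)), ht.trans ((pt_succ _ _).trans ?_)⟩
    congr 1
    funext k
    cases k with
    | zero => rw [Function.update_of_ne (by omega)]; rfl
    | succ k =>
      by_cases h : k = m + 1
      · subst h
        rw [Function.update_self]
        change _ = Function.update t (m + 1) (α (t m)) (m + 1)
        rw [Function.update_self]
        rfl
      · rw [Function.update_of_ne (by omega)]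
        change _ = Function.update t (m + 1) (α (t m)) k
        rw [Function.update_of_ne h]
        rfl

/-- The bonding maps are injective because `J ∩ ker α = 0`. -/
theorem stepMap_injective (hJ : J ≤ (ClosedIdeal.ker α).annihilator) (n : ℕ) :
    Function.Injective (stepMap α J n) := by
  rw [injective_iff_map_eq_zero]
  intro x hx
  have h1 : α x.2 = 0 := congrArg Prod.snd hx
  have h2 : ∀ k : Fin (n + 1), (if h : k.1 < n then x.1 ⟨k.1, h⟩ else J.toQuot x.2) = 0 :=
    fun k => congrFun (congrArg Prod.fst hx) k
  refine Prod.ext (funext fun k => ?_) ?_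
  · have := h2 k.castSucc
    simpa using this
  · have := h2 (Fin.last n)
    simp only [Fin.val_last, lt_irrefl, dite_false] at this
    exact eq_zero_of_mem_annihilator_of_mem (hJ (ClosedIdeal.toQuot_eq_zero.1 this)) h1

theorem norm_pt (hJ : J ≤ (ClosedIdeal.ker α).annihilator) (n : ℕ) (s : ℕ → A) :
    ‖pt hα J n s‖ = ‖ptAmbient hα J n s‖ :=
  norm_limMap (stepMap_injective hJ) n _

theorem natEmb_eq_zero (hJ : J ≤ (ClosedIdeal.ker α).annihilator) {a : A}
    (h : natEmb hα J a = 0) : a = 0 := by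
  rw [natEmb_eq a 0, ← norm_eq_zero, norm_pt hJ, norm_eq_zero] at h
  exact congrArg Prod.snd h

/-- An element of `B_{n+1}` with vanishing `0`-th coordinate annihilates `ker β`, because `β`
does not decrease the norms of the other coordinates. -/
theorem pt_delay_mem_annihilator (hJ : J ≤ (ClosedIdeal.ker α).annihilator) (n : ℕ) (s : ℕ → A) :
    pt hα J (n + 1) (delay s) ∈ (ClosedIdeal.ker (natEndo hα J)).annihilator := by
  have key : ∀ b, ‖pt hα J (n + 1) (delay s) * b‖
      ≤ ‖pt hα J (n + 1) (delay s)‖ * ‖natEndo hα J b‖ := by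
    refine natExt_induction (isClosed_le (by fun_prop)
      (continuous_const.mul (ClosedIdeal.continuous_hom _).norm)) fun m t => ?_
    -- both factors are moved to a common stage
    obtain ⟨r, hr⟩ := exists_pt_delay_of_le (hα := hα) (J := J) (le_max_left n m) s
    obtain ⟨t', ht'⟩ := exists_pt_of_le (hα := hα) (J := J)
      ((le_max_right n m).trans (Nat.le_succ _)) t
    rw [hr, ht']
    set M := max n m
    rw [natEndo_pt, pt_mul, norm_pt hJ, norm_pt hJ, norm_pt hJ, ← shiftMap_ptAmbient]
    set x := ptAmbient hα J (M + 1) (delay r)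
    set y := ptAmbient hα J (M + 1) t'
    rw [← ptAmbient_mul]
    have hx0 : x.1 0 = 0 := by
      change J.toQuot (compress 1 0) = 0
      rw [compress_one, J.toQuot_zero]
    have h0 : 0 ≤ ‖x‖ * ‖shiftMap J M y‖ := by positivity
    refine max_le ((pi_norm_le_iff_of_nonneg h0).2 fun k => ?_) ?_
    · refine Fin.cases ?_ (fun k => ?_) k
      · change ‖x.1 0 * y.1 0‖ ≤ _
        rw [hx0, zero_mul, norm_zero]
        exact h0
      · change ‖x.1 k.succ * (shiftMap J M y).1 k‖ ≤ _
        refine (norm_mul_le _ _).trans (mul_le_mul ((norm_le_pi_norm _ _).trans (norm_fst_le x))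
          ((norm_le_pi_norm _ _).trans (norm_fst_le _)) (norm_nonneg _) (norm_nonneg _))
    · change ‖x.2 * (shiftMap J M y).2‖ ≤ _
      exact (norm_mul_le _ _).trans (mul_le_mul (norm_snd_le x) (norm_snd_le _) (norm_nonneg _)
        (norm_nonneg _))
  intro b (hb : natEndo hα J b = 0)
  have := key b
  rw [hb, norm_zero, mul_zero] at this
  exact norm_le_zero_iff.1 this

theorem isReversible_natEndo (hJ : J ≤ (ClosedIdeal.ker α).annihilator)
    (hβ : Extendible (natEndo hα J)) : IsReversible (natEndo hα J) hβ := by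
  refine isReversible_of_exists hβ ?_
  set N := (ClosedIdeal.ker (natEndo hα J)).annihilator
  have h1 : IsClosed (natEndo hα J '' N) := isClosed_image_hom (natEndo hα J) N.toStarSubalgebra
    N.isClosed
  refine natExt_induction (h1.preimage (continuous_compress (hβ.ext 1))) fun n s => ?_
  refine ⟨pt hα J (n + 1) (delay s), pt_delay_mem_annihilator hJ n s, ?_⟩
  rw [natEndo_pt_delay, compress_natEndo_ext_one]

variable {hβ : Extendible (natEndo hα J)} {L : NatExt hα J →ₗ[ℂ] NatExt hα J}

/-- The transfer operator of the natural extension is the right shift. -/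
theorem transfer_pt (hJ : J ≤ (ClosedIdeal.ker α).annihilator)
    (hL : IsCompleteTransferOperator (natEndo hα J) hβ L) (n : ℕ) (s : ℕ → A) :
    L (pt hα J n s) = pt hα J (n + 1) (delay s) :=
  hL.eq_of (pt_delay_mem_annihilator hJ n s) (by
    rw [natEndo_pt_delay, compress_natEndo_ext_one])

end Points

/-! ### From invariant ideals to `J`-pairs -/

section Pairs

variable {A : Type u} [NonUnitalCStarAlgebra A] {B : Type v} [NonUnitalCStarAlgebra B]

/-- The preimage of an ideal under a homomorphism. -/
def ClosedIdeal.comap (f : A →⋆ₙₐ[ℂ] B) (K : ClosedIdeal B) : ClosedIdeal A where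
  carrier := {a | f a ∈ K}
  add_mem' {a b} (ha : f a ∈ K) (hb : f b ∈ K) := by
    change f (a + b) ∈ K; rw [map_add]; exact add_mem ha hb
  zero_mem' := by change f 0 ∈ K; rw [map_zero]; exact zero_mem K
  smul_mem' c a (ha : f a ∈ K) := by change f (c • a) ∈ K; rw [map_smul]; exact K.smul_mem c ha
  mul_mem_left' a b (hb : f b ∈ K) := by
    change f (a * b) ∈ K; rw [map_mul]; exact K.mul_mem_left _ hb
  mul_mem_right' a b (hb : f b ∈ K) := by
    change f (b * a) ∈ K; rw [map_mul]; exact K.mul_mem_right _ hb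
  isClosed' := K.isClosed.preimage (continuous_hom f)

variable {α : A →⋆ₙₐ[ℂ] A} {hα : Extendible α} {J : ClosedIdeal A}

theorem pt_zero (n : ℕ) : pt hα J n 0 = 0 := by
  rw [pt, ← map_zero (stageHom hα J n)]
  refine congrArg (stageHom hα J n) (Subtype.ext (Prod.ext (funext fun k => ?_) ?_))
  · change J.toQuot (compress _ 0) = 0
    simp [compress, mulL, mulR, J.toQuot_zero]
  · change compress _ 0 = 0
    simp [compress, mulL, mulR]

theorem pt_smul (n : ℕ) (c : ℂ) (s : ℕ → A) : pt hα J n (c • s) = c • pt hα J n s := by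
  rw [pt, pt, ← map_smul]
  refine congrArg (stageHom hα J n) (Subtype.ext (Prod.ext (funext fun k => ?_) ?_))
  · exact congrArg J.toQuot (compress_smul _ _ _)
  · exact compress_smul _ _ _

theorem delay_single (k : ℕ) (a : A) : delay (Pi.single k a) = Pi.single (k + 1) a := by
  funext j
  cases j with
  | zero => rw [Pi.single_eq_of_ne (by omega)]; rfl
  | succ j =>
    by_cases h : j = k
    · subst h; rw [Pi.single_eq_same]; exact Pi.single_eq_same _ _
    · rw [Pi.single_eq_of_ne (by omega)]; exact Pi.single_eq_of_ne h _

theorem pt_single_of_le {k n m : ℕ} (hk : k < n) (h : n ≤ m) (a : A) :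
    pt hα J n (Pi.single k a) = pt hα J m (Pi.single k a) := by
  induction m, h using Nat.le_induction with
  | base => rfl
  | succ m h ih =>
    rw [ih, pt_succ, Pi.single_eq_of_ne (by omega), map_zero]
    congr 1
    refine Function.update_eq_self_iff.2 ?_
    rw [Pi.single_eq_of_ne (by omega)]

theorem pt_eq_sum (n : ℕ) (s : ℕ → A) : pt hα J n s
    = (∑ k ∈ Finset.range n, pt hα J n (Pi.single k (s k))) + pt hα J n (Pi.single n (s n)) := by
  let f : (ℕ → A) →+ NatExt hα J := ⟨⟨pt hα J n, pt_zero n⟩, pt_add n⟩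
  rw [← Finset.sum_range_succ]
  change f s = ∑ k ∈ Finset.range (n + 1), f (Pi.single k (s k))
  rw [← map_sum]
  refine pt_congr fun k hk => congrArg _ ?_
  rw [Finset.sum_apply, Finset.sum_eq_single k, Pi.single_eq_same]
  · intro j _ hj
    exact Pi.single_eq_of_ne hj.symm _
  · intro h
    exact absurd (Finset.mem_range.2 (Nat.lt_succ_of_le hk)) h

theorem natEmb_eq_single (a : A) : natEmb hα J a = pt hα J 0 (Pi.single 0 a) := by
  rw [natEmb_eq a 0]
  refine pt_congr fun k hk => ?_
  obtain rfl : k = 0 := by omega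
  rw [Pi.single_eq_same]; rfl

/-- The homomorphism `a ↦ (q_J(a), 0) ∈ B_1`, which is the multiplication of
`a ∈ A` by the multiplier `1 - β̅_*(1)` of `B`. -/
def defectHom (hα : Extendible α) (J : ClosedIdeal A) : A →⋆ₙₐ[ℂ] NatExt hα J where
  toFun a := pt hα J 1 (Pi.single 0 a)
  map_smul' c a := by
    change _ = c • pt hα J 1 (Pi.single 0 a)
    rw [Pi.single_smul, pt_smul]
  map_zero' := by rw [Pi.single_zero, pt_zero]
  map_add' a b := by rw [Pi.single_add, pt_add]
  map_mul' a b := by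
    rw [pt_mul]
    refine pt_congr fun k hk => congrArg _ ?_
    by_cases h : k = 0
    · subst h; simp only [Pi.single_eq_same]; rfl
    · simp only [Pi.single_eq_of_ne h]; simp [compress, mulL, mulR]
  map_star' a := by
    rw [pt_star]
    refine pt_congr fun k hk => congrArg _ ?_
    by_cases h : k = 0
    · subst h; simp only [Pi.single_eq_same]
    · simp only [Pi.single_eq_of_ne h, star_zero]

theorem defectHom_apply (a : A) : defectHom hα J a = pt hα J 1 (Pi.single 0 a) := rfl

theorem defectHom_eq_zero {a : A} (ha : a ∈ J) : defectHom hα J a = 0 := by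
  rw [defectHom_apply, ← pt_zero 1]
  refine pt_eq_of (Prod.ext (funext fun k => ?_) ?_)
  · obtain rfl : k = 0 := Subsingleton.elim _ _
    exact (ClosedIdeal.toQuot_eq_zero.2 ha)
  · change compress _ ((Pi.single 0 a : ℕ → A) 1) = compress _ 0
    rw [Pi.single_eq_of_ne one_ne_zero]

theorem natEmb_eq_defectHom_add (a : A) :
    natEmb hα J a = defectHom hα J a + pt hα J 1 (Pi.single 1 (α a)) := by
  rw [natEmb_eq a 1, pt_eq_sum, Finset.sum_range_one]
  rfl

theorem pt_single_mul (n k : ℕ) (s : ℕ → A) (a : A) :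
    pt hα J n s * pt hα J n (Pi.single k (α^[k] a))
      = pt hα J n (Pi.single k (compress (cornerUnit hα k) (s k) * α^[k] a)) := by
  rw [pt_mul]
  congr 1
  funext j
  by_cases h : j = k
  · subst h; simp only [Pi.single_eq_same, compress_cornerUnit_iterate]
  · simp only [Pi.single_eq_of_ne h]; simp [compress, mulL, mulR]

/-- If `K` contains an element of `B_n`, then it contains the elements with a single one of its
coordinates, by multiplication with an approximate unit of the coordinate algebra. -/
theorem pt_single_mem (K : ClosedIdeal (NatExt hα J)) {n : ℕ} {s : ℕ → A} (h : pt hα J n s ∈ K)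
    (k : ℕ) : pt hα J n (Pi.single k (compress (cornerUnit hα k) (s k))) ∈ K := by
  obtain ⟨l, hl⟩ := exists_isApproxUnitAlong A
  have := hl.neBot
  have h1 := ((continuous_pt (hα := hα) (J := J) n).tendsto _).comp
    (((continuous_single k).tendsto _).comp
      (tendsto_mul_iterate hα hl k (compress (cornerUnit hα k) (s k))))
  have h2 : mulR (compress (cornerUnit hα k) (s k)) (cornerUnit hα k)
      = compress (cornerUnit hα k) (s k) := toMul_injective (by
    rw [toMul_mulR, toMul_compress, mul_assoc, cornerUnit_mul_self])
  rw [h2] at h1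
  refine K.isClosed.mem_of_tendsto h1 (Eventually.of_forall fun e => ?_)
  change pt hα J n (Pi.single k (compress (cornerUnit hα k) (s k) * α^[k] e)) ∈ K
  rw [← pt_single_mul]
  exact K.mul_mem_right _ h

/-- Iterating `β` moves the coordinate of index `k` to the index `0`. -/
theorem pt_single_zero_mem {K : ClosedIdeal (NatExt hα J)} (hK : ∀ b ∈ K, natEndo hα J b ∈ K)
    {a : A} (k n : ℕ) (hk : k ≤ n) (ha : compress (cornerUnit hα k) a = a)
    (h : pt hα J n (Pi.single k a) ∈ K) : pt hα J (n - k) (Pi.single 0 a) ∈ K := by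
  induction k generalizing n with
  | zero => exact h
  | succ k ih =>
    obtain ⟨m, rfl⟩ : ∃ m, n = m + 1 := ⟨n - 1, by omega⟩
    rw [Nat.add_sub_add_right]
    refine ih m (by omega) ?_ ?_
    · rw [← ha, compress_cornerUnit_of_le hα (Nat.le_succ k)]
    · have h1 := hK _ h
      rw [natEndo_pt] at h1
      convert h1 using 2
      funext j
      by_cases hj : j = k
      · subst hj; rw [Pi.single_eq_same, Pi.single_eq_same, ha]
      · rw [Pi.single_eq_of_ne hj, Pi.single_eq_of_ne (by omega)]; simp [compress, mulL, mulR]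

/-- If `K` contains an element of `B_n` then it contains the elements `q a` and `a` of `B`, for the
coordinates `a` of index `k < n` and `k = n`, respectively. -/
theorem coordinates_mem_of_pt_mem {K : ClosedIdeal (NatExt hα J)} (hK : ∀ b ∈ K, natEndo hα J b ∈ K)
    {n : ℕ} {s : ℕ → A} (h : pt hα J n s ∈ K) :
    (∀ k < n, defectHom hα J (compress (cornerUnit hα k) (s k)) ∈ K) ∧
      natEmb hα J (compress (cornerUnit hα n) (s n)) ∈ K := by
  have h1 : ∀ k ≤ n, pt hα J (n - k) (Pi.single 0 (compress (cornerUnit hα k) (s k))) ∈ K :=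
    fun k hk => pt_single_zero_mem hK k n hk (compress_cornerUnit_of_le hα le_rfl _)
      (pt_single_mem K h k)
  refine ⟨fun k hk => ?_, ?_⟩
  · rw [defectHom_apply, pt_single_of_le zero_lt_one (by omega : 1 ≤ n - k)]
    exact h1 k hk.le
  · rw [natEmb_eq_single]
    simpa using h1 n le_rfl

variable {hβ : Extendible (natEndo hα J)} {L : NatExt hα J →ₗ[ℂ] NatExt hα J}

theorem transfer_natEndo_natEmb (hJ : J ≤ (ClosedIdeal.ker α).annihilator)
    (hL : IsCompleteTransferOperator (natEndo hα J) hβ L) (a : A) :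
    L (natEndo hα J (natEmb hα J a)) = pt hα J 1 (Pi.single 1 (α a)) := by
  rw [natEndo_natEmb, natEmb_eq_single, transfer_pt hJ hL, delay_single]

theorem mulL_one_sub_natEmb (hJ : J ≤ (ClosedIdeal.ker α).annihilator)
    (hL : IsCompleteTransferOperator (natEndo hα J) hβ L) (hL' : Extendible L) (a : A) :
    mulL (1 - hL'.ext 1) (natEmb hα J a) = defectHom hα J a := by
  rw [hL.mulL_one_sub, transfer_natEndo_natEmb hJ hL, natEmb_eq_defectHom_add, add_sub_cancel_right]

theorem iterate_transfer_defectHom (hJ : J ≤ (ClosedIdeal.ker α).annihilator)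
    (hL : IsCompleteTransferOperator (natEndo hα J) hβ L) (k : ℕ) (a : A) :
    L^[k] (defectHom hα J a) = pt hα J (k + 1) (Pi.single k a) := by
  induction k with
  | zero => rfl
  | succ k ih => rw [Function.iterate_succ_apply', ih, transfer_pt hJ hL, delay_single]

theorem iterate_transfer_natEmb (hJ : J ≤ (ClosedIdeal.ker α).annihilator)
    (hL : IsCompleteTransferOperator (natEndo hα J) hβ L) (n : ℕ) (a : A) :
    L^[n] (natEmb hα J a) = pt hα J n (Pi.single n a) := by
  induction n with
  | zero => exact natEmb_eq_single a
  | succ k ih => rw [Function.iterate_succ_apply', ih, transfer_pt hJ hL, delay_single]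

/-- The transfer operator moves coordinates to the right, so that an element of `B_n` is the sum of
the elements `β_*ᵏ(q s_k)`, for `k < n`, and `β_*ⁿ(s_n)`. -/
theorem pt_eq_sum_iterate (hJ : J ≤ (ClosedIdeal.ker α).annihilator)
    (hL : IsCompleteTransferOperator (natEndo hα J) hβ L) (n : ℕ) (s : ℕ → A) : pt hα J n s
    = (∑ k ∈ Finset.range n, L^[k] (defectHom hα J (s k))) + L^[n] (natEmb hα J (s n)) := by
  rw [pt_eq_sum, iterate_transfer_natEmb hJ hL]
  congr 1
  refine Finset.sum_congr rfl fun k hk => ?_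
  rw [iterate_transfer_defectHom hJ hL, pt_single_of_le (Nat.lt_succ_self k)]
  exact Finset.mem_range.1 hk

/-- The `J`-pair `(K ∩ A, {a | q a ∈ K})` of an invariant ideal `K`, where `q = 1 - β̅_*(1)`. -/
def pairOf (hJ : J ≤ (ClosedIdeal.ker α).annihilator)
    (hL : IsCompleteTransferOperator (natEndo hα J) hβ L) (K : InvariantIdeal (natEndo hα J)) :
    JPair α J where
  I := ClosedIdeal.comap (natEmbHom hα J) K.ideal
  I' := ClosedIdeal.comap (defectHom hα J) K.ideal
  positive a ha := by
    change natEmb hα J (α a) ∈ K.ideal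
    rw [← natEndo_natEmb]
    exact K.positive _ ha
  J_le a ha := by
    change defectHom hα J a ∈ K.ideal
    rw [defectHom_eq_zero ha]
    exact zero_mem _
  inter_eq := by
    have h1 : ∀ a, natEmb hα J (α a) ∈ K.ideal → pt hα J 1 (Pi.single 1 (α a)) ∈ K.ideal :=
      fun a ha => by
        rw [← transfer_natEndo_natEmb hJ hL, natEndo_natEmb]
        exact hL.map_mem K ha
    ext a
    constructor
    · rintro ⟨h2, h3⟩
      change natEmb hα J a ∈ K.ideal
      rw [natEmb_eq_defectHom_add]
      exact add_mem h2 (h1 a h3)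
    · intro (h2 : natEmb hα J a ∈ K.ideal)
      have h3 : natEmb hα J (α a) ∈ K.ideal := by
        rw [← natEndo_natEmb]
        exact K.positive _ h2
      refine ⟨?_, h3⟩
      change defectHom hα J a ∈ K.ideal
      rw [natEmb_eq_defectHom_add] at h2
      simpa using sub_mem h2 (h1 a h3)

theorem mem_pairOf_I {hJ : J ≤ (ClosedIdeal.ker α).annihilator}
    {hL : IsCompleteTransferOperator (natEndo hα J) hβ L} {K : InvariantIdeal (natEndo hα J)}
    {a : A} : a ∈ (pairOf hJ hL K).I ↔ natEmb hα J a ∈ K.ideal := Iff.rfl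

theorem mem_pairOf_I' {hJ : J ≤ (ClosedIdeal.ker α).annihilator}
    {hL : IsCompleteTransferOperator (natEndo hα J) hβ L} {K : InvariantIdeal (natEndo hα J)}
    {a : A} : a ∈ (pairOf hJ hL K).I' ↔ defectHom hα J a ∈ K.ideal := Iff.rfl

theorem mem_of_pairOf {hJ : J ≤ (ClosedIdeal.ker α).annihilator}
    {hL : IsCompleteTransferOperator (natEndo hα J) hβ L} {K : InvariantIdeal (natEndo hα J)}
    {n : ℕ} {x : ℕ → A} {a : A} (hx : ∀ k < n, x k ∈ (pairOf hJ hL K).I')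
    (ha : a ∈ (pairOf hJ hL K).I) :
    (∑ k ∈ Finset.range n, L^[k] (defectHom hα J (x k))) + L^[n] (natEmb hα J a) ∈ K.ideal := by
  have h1 : ∀ k b, b ∈ K.ideal → L^[k] b ∈ K.ideal := fun k b hb => by
    induction k with
    | zero => exact hb
    | succ k ih => rw [Function.iterate_succ_apply']; exact hL.map_mem K ih
  refine add_mem (sum_mem fun k hk => h1 _ _ ?_) (h1 _ _ ha)
  exact hx k (Finset.mem_range.1 hk)

/-- The intersection of an invariant ideal with `B_n`, in terms of its `J`-pair. -/
theorem inter_range_stageHom (hJ : J ≤ (ClosedIdeal.ker α).annihilator)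
    (hL : IsCompleteTransferOperator (natEndo hα J) hβ L) (K : InvariantIdeal (natEndo hα J))
    (n : ℕ) : (K.ideal : Set (NatExt hα J)) ∩ Set.range (stageHom hα J n) =
      {b | ∃ (x : ℕ → A) (a : A), (∀ k < n, x k ∈ (pairOf hJ hL K).I') ∧
        a ∈ (pairOf hJ hL K).I ∧
        b = (∑ k ∈ Finset.range n, L^[k] (defectHom hα J (x k))) + L^[n] (natEmb hα J a)} := by
  rw [range_stageHom]
  ext b
  constructor
  · rintro ⟨h, s, rfl⟩
    obtain ⟨h1, h2⟩ := coordinates_mem_of_pt_mem K.positive h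
    refine ⟨fun k => compress (cornerUnit hα k) (s k), compress (cornerUnit hα n) (s n), h1, h2, ?_⟩
    rw [← pt_eq_sum_iterate hJ hL n fun k => compress (cornerUnit hα k) (s k)]
    exact pt_congr fun k _ => (compress_cornerUnit_of_le hα le_rfl _).symm
  · rintro ⟨x, a, hx, ha, rfl⟩
    refine ⟨mem_of_pairOf hx ha, Function.update x n a, ?_⟩
    rw [pt_eq_sum_iterate hJ hL, Function.update_self]
    congr 1
    refine Finset.sum_congr rfl fun k hk => ?_
    rw [Function.update_of_ne (Finset.mem_range.1 hk).ne]

/-- `B_n` is a `C*`-algebra, that is, it is closed. -/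
theorem isClosed_stage (n : ℕ) : IsClosed (stage hα J n : Set (Ambient J n)) := by
  have h1 : ∀ k, IsClosed (corner hα k : Set A) := fun k => by
    have : (corner hα k : Set A) = {a | compress (cornerUnit hα k) a = a} := by
      ext a
      constructor
      · rintro ⟨b, rfl⟩
        exact compress_cornerUnit_of_le hα le_rfl b
      · intro h
        exact ⟨a, h⟩
    rw [this]
    exact isClosed_eq (continuous_compress _) continuous_id
  have h2 : (stage hα J n : Set (Ambient J n)) = (⋂ k : Fin n, {x | x.1 k ∈ J.quotHom ''
      (corner hα k)}) ∩ {x | x.2 ∈ corner hα n} := by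
    ext x
    change ((∀ k : Fin n, _) ∧ _) ↔ _
    rw [Set.mem_inter_iff, Set.mem_iInter]
    rfl
  rw [h2]
  refine (isClosed_iInter fun k => ?_).inter ((h1 n).preimage continuous_snd)
  exact (isClosed_image_hom J.quotHom (corner hα k) (h1 k)).preimage
    ((continuous_apply k).comp continuous_fst)

/-- An ideal of `B` is determined by its intersections with the algebras `B_n`: for `b ∈ B_n` the
norm of `b + K` depends only on the kernel of `B_n → B / K`. -/
theorem ideal_le_of_forall_stage {K K' : ClosedIdeal (NatExt hα J)}
    (h : ∀ n, ∀ b ∈ Set.range (stageHom hα J n), b ∈ K → b ∈ K') : K ≤ K' := by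
  have key : ∀ b, ‖K'.toQuot b‖ ≤ ‖K.toQuot b‖ := by
    refine natExt_induction (isClosed_le K'.continuous_toQuot.norm K.continuous_toQuot.norm)
      fun n s => ?_
    have := isClosed_stage (hα := hα) (J := J) n
    exact norm_le_norm_of_ker_le (K.quotHom.comp (stageHom hα J n))
      (K'.quotHom.comp (stageHom hα J n)) (fun x hx => ClosedIdeal.toQuot_eq_zero.2
        (h n _ ⟨x, rfl⟩ (ClosedIdeal.toQuot_eq_zero.1 hx))) ⟨_, ptAmbient_mem hα J n s⟩
  intro b hb
  have := key b
  rw [ClosedIdeal.toQuot_eq_zero.2 hb, norm_zero] at this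
  exact ClosedIdeal.toQuot_eq_zero.1 (norm_le_zero_iff.1 this)

theorem JPair.le_iff {P Q : JPair α J} : P ≤ Q ↔ P.I ≤ Q.I ∧ P.I' ≤ Q.I' := Iff.rfl

theorem pairOf_le_iff (hJ : J ≤ (ClosedIdeal.ker α).annihilator)
    (hL : IsCompleteTransferOperator (natEndo hα J) hβ L) (K K' : InvariantIdeal (natEndo hα J)) :
    pairOf hJ hL K ≤ pairOf hJ hL K' ↔ K ≤ K' := by
  constructor
  · intro hle
    obtain ⟨h1, h2⟩ := JPair.le_iff.1 hle
    refine ideal_le_of_forall_stage fun n b hb hbK => ?_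
    have h3 : b ∈ (K.ideal : Set (NatExt hα J)) ∩ Set.range (stageHom hα J n) := ⟨hbK, hb⟩
    rw [inter_range_stageHom hJ hL] at h3
    obtain ⟨x, a, hx, ha, rfl⟩ := h3
    exact mem_of_pairOf (hJ := hJ) (hL := hL) (fun k hk => h2 (hx k hk)) (h1 ha)
  · intro h
    exact JPair.le_iff.2 ⟨fun a ha => h ha, fun a ha => h ha⟩

end Pairs

/-! ### Quotient systems -/

section QuotientSystem

variable {A : Type u} [NonUnitalCStarAlgebra A] {α : A →⋆ₙₐ[ℂ] A}

theorem IsApproxUnitAlong.toQuot {ι : Type w} {l : Filter ι} {e : ι → A}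
    (h : IsApproxUnitAlong l e) (I : ClosedIdeal A) :
    IsApproxUnitAlong l fun i => I.toQuot (e i) where
  neBot := h.neBot
  norm_le := h.norm_le.mono fun i hi => (I.norm_toQuot_le _).trans hi
  isSelfAdjoint := h.isSelfAdjoint.mono fun i hi => congrArg I.toQuot hi.star_eq
  tendsto_mul x := by
    obtain ⟨a, rfl⟩ := I.toQuot_surjective x
    exact (I.continuous_toQuot.tendsto a).comp (h.tendsto_mul a)

/-- The convergence of `α(e_i) a` passes to the quotient. -/
theorem extendible_quotEndo (hα : Extendible α) (I : ClosedIdeal A)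
    (hI : IsPositivelyInvariant α I) : Extendible (quotEndo α I hI) := by
  obtain ⟨l, hl⟩ := exists_isApproxUnitAlong A
  refine extendible_of_tendsto _ (hl.toQuot I) fun x => ?_
  obtain ⟨a, rfl⟩ := I.toQuot_surjective x
  exact ⟨_, (I.continuous_toQuot.tendsto _).comp (tendsto_ext_one hα hl a)⟩

variable {I : ClosedIdeal A} {hI : IsPositivelyInvariant α I}

theorem iterate_quotEndo (k : ℕ) (a : A) :
    (quotEndo α I hI)^[k] (I.toQuot a) = I.toQuot (α^[k] a) := by
  induction k with
  | zero => rfl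
  | succ k ih => rw [Function.iterate_succ_apply', ih, Function.iterate_succ_apply']; rfl

theorem toQuot_compress (hα : Extendible α) (h : Extendible (quotEndo α I hI)) (k : ℕ) (a : A) :
    I.toQuot (compress (cornerUnit hα k) a) = compress (cornerUnit h k) (I.toQuot a) := by
  obtain ⟨l, hl⟩ := exists_isApproxUnitAlong A
  have := hl.neBot
  have h1 : ∀ a, I.toQuot (mulL (cornerUnit hα k) a) = mulL (cornerUnit h k) (I.toQuot a) :=
    fun a => tendsto_nhds_unique
      ((I.continuous_toQuot.tendsto _).comp (tendsto_iterate_mul hα hl k a))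
      ((tendsto_iterate_mul h (hl.toQuot I) k (I.toQuot a)).congr fun e => by
        rw [iterate_quotEndo]; rfl)
  have h2 : I.toQuot (mulR a (cornerUnit hα k)) = mulR (I.toQuot a) (cornerUnit h k) :=
    tendsto_nhds_unique
      ((I.continuous_toQuot.tendsto _).comp (tendsto_mul_iterate hα hl k a))
      ((tendsto_mul_iterate h (hl.toQuot I) k (I.toQuot a)).congr fun e => by
        rw [iterate_quotEndo]; rfl)
  rw [compress, compress, h1, h2]

variable {J : ClosedIdeal A}

theorem toQuot_mem_image {I' : ClosedIdeal A} (h : I ≤ I') {a : A} :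
    I.toQuot a ∈ ClosedIdeal.image I I' h ↔ a ∈ I' := by
  constructor
  · rintro ⟨b, hb, hab⟩
    have h1 : b - a ∈ I' := h (ClosedIdeal.toQuot_eq_iff.1 hab)
    simpa using sub_mem (H := I') hb h1
  · intro ha
    exact ⟨a, ha, rfl⟩

/-- For `a ∈ I'` and `α(b) ∈ I`, the product `a b` lies in `I' ∩ α⁻¹(I) = I`. -/
theorem image_le_annihilator (P : JPair α J) : ClosedIdeal.image P.I P.I' P.I_le
    ≤ (ClosedIdeal.ker (quotEndo α P.I P.positive)).annihilator := by
  rintro _ ⟨a, ha, rfl⟩ x hx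
  obtain ⟨b, rfl⟩ := P.I.toQuot_surjective x
  have hb : α b ∈ P.I := ClosedIdeal.toQuot_eq_zero.1 hx
  have h1 : a * b ∈ (P.I : Set A) := by
    rw [← P.inter_eq]
    refine ⟨P.I'.mul_mem_right b ha, ?_⟩
    change α (a * b) ∈ P.I
    rw [map_mul]
    exact P.I.mul_mem_left _ hb
  exact ClosedIdeal.toQuot_eq_zero.2 h1

/-! ### The homomorphism between natural extensions induced by a `J`-pair -/

variable {X : ℕ → Type u} [∀ n, NonUnitalCStarAlgebra (X n)]
  {Y : ℕ → Type u} [∀ n, NonUnitalCStarAlgebra (Y n)]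

theorem limHom_mem {T : ∀ n, X n →⋆ₙₐ[ℂ] X (n + 1)} {T' : ∀ n, Y n →⋆ₙₐ[ℂ] Y (n + 1)}
    {S : ∀ n, NonUnitalStarSubalgebra ℂ (X n)} {S' : ∀ n, NonUnitalStarSubalgebra ℂ (Y n)}
    {f : ∀ n, X n →⋆ₙₐ[ℂ] Y n} (hf : ∀ n x, T' n (f n x) = f (n + 1) (T n x))
    (hS : ∀ n, ∀ x ∈ S n, f n x ∈ S' n) {y : SeqQuot X} (hy : y ∈ limSubalgebra T S) :
    limHom f y ∈ limSubalgebra T' S' := by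
  have h : limSubalgebra T S ≤ (limSubalgebra T' S').comap (limHom f) := by
    refine NonUnitalStarSubalgebra.topologicalClosure_minimal _ (iSup_le fun n => ?_) ?_
    · rintro _ ⟨x, hx, rfl⟩
      change limHom f (limMap T n x) ∈ limSubalgebra T' S'
      rw [limHom_limMap hf]
      exact limMap_mem T' S' (hS n x hx)
    · exact (NonUnitalStarSubalgebra.isClosed_topologicalClosure
        (⨆ n, (S' n).map (limMap T' n))).preimage (ClosedIdeal.continuous_hom (limHom f))
  exact h hy

/-- The coordinatewise map `(A / J)ⁿ ⊕ A → ((A / I) / q_I(I'))ⁿ ⊕ A / I`. -/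
def ambientHom (P : JPair α J) (n : ℕ) :
    Ambient J n →⋆ₙₐ[ℂ] Ambient (ClosedIdeal.image P.I P.I' P.I_le) n :=
  let r := ClosedIdeal.quotMap P.I.quotHom J (ClosedIdeal.image P.I P.I' P.I_le)
    fun a ha => ⟨a, P.J_le ha, rfl⟩
  { toFun := fun x => (fun k => r (x.1 k), P.I.quotHom x.2)
    map_smul' := fun c x => Prod.ext (funext fun k => map_smul r c (x.1 k)) (map_smul _ c x.2)
    map_zero' := Prod.ext (funext fun _ => map_zero r) (map_zero P.I.quotHom)
    map_add' := fun x y => Prod.ext (funext fun k => map_add r (x.1 k) (y.1 k)) (map_add _ x.2 y.2)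
    map_mul' := fun x y => Prod.ext (funext fun k => map_mul r (x.1 k) (y.1 k)) (map_mul _ x.2 y.2)
    map_star' := fun x => Prod.ext (funext fun k => map_star r (x.1 k)) (map_star P.I.quotHom x.2) }

theorem stepMap_ambientHom (P : JPair α J) (n : ℕ) (x : Ambient J n) :
    stepMap (quotEndo α P.I P.positive) (ClosedIdeal.image P.I P.I' P.I_le) n (ambientHom P n x)
      = ambientHom P (n + 1) (stepMap α J n x) := by
  refine Prod.ext (funext fun k => ?_) rfl
  change (if h : k.1 < n then _ else _) = ClosedIdeal.quotMap P.I.quotHom J _ _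
    (if h : k.1 < n then _ else _)
  split_ifs
  · rfl
  · rfl

variable (hα : Extendible α) (P : JPair α J) (h : Extendible (quotEndo α P.I P.positive))

theorem ambientHom_ptAmbient (n : ℕ) (s : ℕ → A) : ambientHom P n (ptAmbient hα J n s)
    = ptAmbient h (ClosedIdeal.image P.I P.I' P.I_le) n fun k => P.I.toQuot (s k) :=
  Prod.ext (funext fun k => congrArg (ClosedIdeal.toQuot _) (toQuot_compress hα h k (s k)))
    (toQuot_compress hα h n (s n))

/-- The homomorphism from the natural reversible `J`-extension of `(A, α)` to the natural
reversible `q_I(I')`-extension of `(A / I, α_I)`. -/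
def natQuotHom : NatExt hα J →⋆ₙₐ[ℂ] NatExt h (ClosedIdeal.image P.I P.I' P.I_le) :=
  NonUnitalStarAlgHom.codRestrict
    ((limHom (ambientHom P)).comp (NonUnitalStarSubalgebraClass.subtype (natSubalgebra hα J)))
    (natSubalgebra h (ClosedIdeal.image P.I P.I' P.I_le)) fun y =>
      limHom_mem (stepMap_ambientHom P) (fun n x hx => by
        obtain ⟨s, rfl⟩ := exists_ptAmbient hx
        rw [ambientHom_ptAmbient hα P h]
        exact ptAmbient_mem h _ n _) y.2

variable {hα P h}

theorem natQuotHom_pt (n : ℕ) (s : ℕ → A) : natQuotHom hα P h (pt hα J n s)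
    = pt h (ClosedIdeal.image P.I P.I' P.I_le) n fun k => P.I.toQuot (s k) :=
  Subtype.ext <| by
    change limHom (ambientHom P) (limMap (stepMap α J) n (ptAmbient hα J n s))
      = limMap (stepMap _ _) n (ptAmbient h (ClosedIdeal.image P.I P.I' P.I_le) n
        fun k => P.I.toQuot (s k))
    rw [limHom_limMap (stepMap_ambientHom P), ambientHom_ptAmbient hα P h]

theorem toQuot_single (k : ℕ) (a : A) :
    (fun j => P.I.toQuot ((Pi.single k a : ℕ → A) j)) = Pi.single k (P.I.toQuot a) := by
  funext j
  by_cases hj : j = k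
  · subst hj; rw [Pi.single_eq_same, Pi.single_eq_same]
  · rw [Pi.single_eq_of_ne hj, Pi.single_eq_of_ne hj, P.I.toQuot_zero]

theorem natQuotHom_natEmb (a : A) : natQuotHom hα P h (natEmb hα J a)
    = natEmb h (ClosedIdeal.image P.I P.I' P.I_le) (P.I.toQuot a) := by
  rw [natEmb_eq_single, natEmb_eq_single, natQuotHom_pt, toQuot_single]

theorem natQuotHom_defectHom (a : A) : natQuotHom hα P h (defectHom hα J a)
    = defectHom h (ClosedIdeal.image P.I P.I' P.I_le) (P.I.toQuot a) := by
  rw [defectHom_apply, defectHom_apply, natQuotHom_pt, toQuot_single]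

theorem natQuotHom_natEndo (b : NatExt hα J) : natQuotHom hα P h (natEndo hα J b)
    = natEndo h (ClosedIdeal.image P.I P.I' P.I_le) (natQuotHom hα P h b) := by
  have hc := ClosedIdeal.continuous_hom (natQuotHom hα P h)
  refine natExt_induction (p := fun b => natQuotHom hα P h (natEndo hα J b)
    = natEndo h (ClosedIdeal.image P.I P.I' P.I_le) (natQuotHom hα P h b))
    (isClosed_eq (hc.comp (ClosedIdeal.continuous_hom _))
      ((ClosedIdeal.continuous_hom _).comp hc)) (fun n s => ?_) b
  obtain ⟨t, ht⟩ := exists_pt_of_le (hα := hα) (J := J) (Nat.le_succ n) s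
  rw [ht, natEndo_pt, natQuotHom_pt, natQuotHom_pt, natEndo_pt]
  simp only [toQuot_compress hα h]

theorem natQuotHom_surjective : Function.Surjective (natQuotHom hα P h) := by
  intro x
  refine natExt_induction (p := fun x => x ∈ Set.range (natQuotHom hα P h))
    (isClosed_range_hom _) (fun n t => ?_) x
  choose s hs using fun k => P.I.toQuot_surjective (t k)
  exact ⟨pt hα J n s, by rw [natQuotHom_pt]; congr 1; exact funext hs⟩

theorem natQuotHom_transfer {hβ : Extendible (natEndo hα J)} {L : NatExt hα J →ₗ[ℂ] NatExt hα J}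
    (hJ : J ≤ (ClosedIdeal.ker α).annihilator)
    (hL : IsCompleteTransferOperator (natEndo hα J) hβ L)
    {hγ : Extendible (natEndo h (ClosedIdeal.image P.I P.I' P.I_le))}
    {M : NatExt h (ClosedIdeal.image P.I P.I' P.I_le) →ₗ[ℂ]
      NatExt h (ClosedIdeal.image P.I P.I' P.I_le)}
    (hM : IsCompleteTransferOperator (natEndo h (ClosedIdeal.image P.I P.I' P.I_le)) hγ M)
    (b : NatExt hα J) : natQuotHom hα P h (L b) = M (natQuotHom hα P h b) := by
  have hc := ClosedIdeal.continuous_hom (natQuotHom hα P h)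
  refine natExt_induction (p := fun b => natQuotHom hα P h (L b) = M (natQuotHom hα P h b))
    (isClosed_eq (hc.comp hL.continuous) (hM.continuous.comp hc)) (fun n s => ?_) b
  rw [transfer_pt hJ hL, natQuotHom_pt, natQuotHom_pt, transfer_pt (image_le_annihilator P) hM]
  congr 1
  funext k
  cases k <;> rfl

theorem mem_of_defectHom_eq_zero (hJ : J ≤ (ClosedIdeal.ker α).annihilator) {a : A}
    (h : defectHom hα J a = 0) : a ∈ J := by
  rw [defectHom_apply, ← norm_eq_zero, norm_pt hJ, norm_eq_zero] at h
  exact ClosedIdeal.toQuot_eq_zero.1 (congrFun (congrArg Prod.fst h) 0)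

/-- Every `J`-pair `P` is the `J`-pair of the kernel of `natQuotHom P`. -/
theorem exists_pairOf_eq {hβ : Extendible (natEndo hα J)} {L : NatExt hα J →ₗ[ℂ] NatExt hα J}
    (hJ : J ≤ (ClosedIdeal.ker α).annihilator)
    (hL : IsCompleteTransferOperator (natEndo hα J) hβ L) (P : JPair α J)
    (h : Extendible (quotEndo α P.I P.positive)) :
    ∃ K, pairOf hJ hL K = P ∧ ∀ b, b ∈ K.ideal ↔ natQuotHom hα P h b = 0 := by
  obtain ⟨M, hM⟩ := isReversible_natEndo (image_le_annihilator P) (extendible_natEndo (hα := h))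
  let K := InvariantIdeal.ofTransfer hL (ClosedIdeal.ker (natQuotHom hα P h))
    (fun b (hb : natQuotHom hα P h b = 0) => by
      change natQuotHom hα P h _ = 0
      rw [natQuotHom_natEndo, hb, map_zero])
    (fun b (hb : natQuotHom hα P h b = 0) => by
      change natQuotHom hα P h _ = 0
      rw [natQuotHom_transfer hJ hL hM, hb, map_zero])
  have hK : ∀ b, b ∈ K.ideal ↔ natQuotHom hα P h b = 0 := fun _ => Iff.rfl
  have h1 : ∀ a, a ∈ (pairOf hJ hL K).I ↔ a ∈ P.I := fun a => by
    rw [mem_pairOf_I, hK, natQuotHom_natEmb, ← ClosedIdeal.toQuot_eq_zero]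
    refine ⟨natEmb_eq_zero (image_le_annihilator P), fun h0 => ?_⟩
    rw [h0]
    exact map_zero (natEmbHom h _)
  have h2 : ∀ a, a ∈ (pairOf hJ hL K).I' ↔ a ∈ P.I' := fun a => by
    rw [mem_pairOf_I', hK, natQuotHom_defectHom, ← toQuot_mem_image P.I_le]
    exact ⟨mem_of_defectHom_eq_zero (image_le_annihilator P), defectHom_eq_zero⟩
  exact ⟨K, le_antisymm (JPair.le_iff.2 ⟨fun a => (h1 a).1, fun a => (h2 a).1⟩)
    (JPair.le_iff.2 ⟨fun a => (h1 a).2, fun a => (h2 a).2⟩), hK⟩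

theorem systemsEquivalent_quot {hβ : Extendible (natEndo hα J)}
    {L : NatExt hα J →ₗ[ℂ] NatExt hα J} (hJ : J ≤ (ClosedIdeal.ker α).annihilator)
    (hL : IsCompleteTransferOperator (natEndo hα J) hβ L) (K : InvariantIdeal (natEndo hα J))
    (h : Extendible (quotEndo α (pairOf hJ hL K).I (pairOf hJ hL K).positive)) :
    SystemsEquivalent (quotEndo (natEndo hα J) K.ideal K.positive)
      (natEndo h (ClosedIdeal.image (pairOf hJ hL K).I (pairOf hJ hL K).I'
        (pairOf hJ hL K).I_le)) := by
  obtain ⟨K', hK', hker⟩ := exists_pairOf_eq hJ hL (pairOf hJ hL K) h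
  obtain rfl : K' = K := le_antisymm ((pairOf_le_iff hJ hL _ _).1 hK'.le)
    ((pairOf_le_iff hJ hL _ _).1 hK'.ge)
  set f := ClosedIdeal.quotLift (natQuotHom hα _ h) K'.ideal fun b => (hker b).1 with hf
  have hf1 : Function.Bijective f := by
    refine ⟨ClosedIdeal.quotLift_injective _ _ _ fun b => (hker b).2, fun x => ?_⟩
    obtain ⟨b, rfl⟩ := natQuotHom_surjective (hα := hα) x
    exact ⟨K'.ideal.toQuot b, rfl⟩
  refine ⟨StarAlgEquiv.ofBijective f hf1, fun x => ?_⟩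
  obtain ⟨b, rfl⟩ := K'.ideal.toQuot_surjective x
  exact natQuotHom_natEndo b

end QuotientSystem

/-! ### The lattice of `J`-pairs -/

section Lattice

variable {A : Type u} [NonUnitalCStarAlgebra A] {α : A →⋆ₙₐ[ℂ] A} {J : ClosedIdeal A}

/-- The intersection of a family of ideals. -/
def ClosedIdeal.iInter {ι : Sort v} (f : ι → ClosedIdeal A) : ClosedIdeal A where
  carrier := {a | ∀ i, a ∈ f i}
  add_mem' ha hb i := add_mem (ha i) (hb i)
  zero_mem' i := zero_mem (f i)
  smul_mem' c _ ha i := (f i).smul_mem c (ha i)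
  mul_mem_left' a _ hb i := (f i).mul_mem_left a (hb i)
  mul_mem_right' a _ hb i := (f i).mul_mem_right a (hb i)
  isClosed' := by
    have : {a | ∀ i, a ∈ f i} = ⋂ i, (f i : Set A) := by ext; simp
    rw [this]
    exact isClosed_iInter fun i => (f i).isClosed

/-- The entrywise intersection of a set of `J`-pairs. -/
def JPair.inter (S : Set (JPair α J)) : JPair α J where
  I := ClosedIdeal.iInter fun P : S => P.1.I
  I' := ClosedIdeal.iInter fun P : S => P.1.I'
  positive a ha P := P.1.positive a (ha P)
  J_le a ha P := P.1.J_le ha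
  inter_eq := by
    have key : ∀ (P : JPair α J) (a : A), a ∈ P.I' ∧ α a ∈ P.I ↔ a ∈ P.I := fun P a =>
      Set.ext_iff.1 P.inter_eq a
    ext a
    exact ⟨fun h P => (key P.1 a).1 ⟨h.1 P, h.2 P⟩,
      fun h => ⟨fun P => ((key P.1 a).2 (h P)).1, fun P => ((key P.1 a).2 (h P)).2⟩⟩

theorem JPair.isGLB_inter (S : Set (JPair α J)) : IsGLB S (JPair.inter S) :=
  ⟨fun P hP => ⟨fun _ ha => ha ⟨P, hP⟩, fun _ ha => ha ⟨P, hP⟩⟩,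
    fun _ hQ => ⟨fun _ ha P => (hQ P.2).1 ha, fun _ ha P => (hQ P.2).2 ha⟩⟩

end Lattice

end CStarDyn

end

theorem mainTheorem2 {A : Type*} [NonUnitalCStarAlgebra A] (α : A →⋆ₙₐ[ℂ] A) (hα : Extendible α)
    (J : ClosedIdeal A) (hJ : J ≤ (ClosedIdeal.ker α).annihilator) :
    -- the natural reversible `J`-extension `(B, β)` is a reversible `C*`-dynamical system
    ∃ hβ : Extendible (natEndo hα J),
      IsReversible (natEndo hα J) hβ ∧
      -- `L = β_*` is the complete transfer operator; `1 - hL.ext 1` is the multiplier `q` of `B`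
      ∀ L : NatExt hα J →ₗ[ℂ] NatExt hα J, IsCompleteTransferOperator (natEndo hα J) hβ L →
        ∃ hL : Extendible L,
        -- the order isomorphism between invariant ideals and `J`-pairs
        ∃ F : InvariantIdeal (natEndo hα J) ≃o JPair α J,
          (∀ K : InvariantIdeal (natEndo hα J),
            ((F K).I : Set A) = {a | natEmb hα J a ∈ K.ideal} ∧
            ((F K).I' : Set A) = {a | mulL (1 - hL.ext 1) (natEmb hα J a) ∈ K.ideal} ∧
            ∀ n : ℕ, (K.ideal : Set (NatExt hα J)) ∩ Set.range (stageHom hα J n) =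
              {b | ∃ (x : ℕ → A) (a : A), (∀ k < n, x k ∈ (F K).I') ∧ a ∈ (F K).I ∧
                b = (∑ k ∈ Finset.range n, L^[k] (mulL (1 - hL.ext 1) (natEmb hα J (x k))))
                  + L^[n] (natEmb hα J a)}) ∧
          -- the `J`-pairs form a lattice
          (∀ P Q : JPair α J,
            (∃ R, IsLUB ({P, Q} : Set (JPair α J)) R) ∧
            (∃ R, IsGLB ({P, Q} : Set (JPair α J)) R)) ∧
          -- the quotient systems
          (∀ K : InvariantIdeal (natEndo hα J),
            Extendible (quotEndo (natEndo hα J) K.ideal K.positive) ∧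
            ∃ h : Extendible (quotEndo α (F K).I (F K).positive),
              ClosedIdeal.image (F K).I (F K).I' (F K).I_le
                ≤ (ClosedIdeal.ker (quotEndo α (F K).I (F K).positive)).annihilator ∧
              SystemsEquivalent (quotEndo (natEndo hα J) K.ideal K.positive)
                (natEndo h (ClosedIdeal.image (F K).I (F K).I' (F K).I_le))) := by
  refine ⟨extendible_natEndo, isReversible_natEndo hJ _, fun L hL => ⟨hL.extendible, ?_⟩⟩
  refine ⟨RelIso.ofSurjective (OrderEmbedding.ofMapLEIff (pairOf hJ hL) (pairOf_le_iff hJ hL))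
    fun P => ?_, fun K => ⟨rfl, ?_, fun n => ?_⟩,
    fun P Q => ⟨⟨_, isGLB_upperBounds.1 (JPair.isGLB_inter _)⟩, _, JPair.isGLB_inter _⟩,
    fun K => ⟨extendible_quotEndo extendible_natEndo _ _, extendible_quotEndo hα _ _,
      image_le_annihilator (pairOf hJ hL K), systemsEquivalent_quot hJ hL K _⟩⟩
  · obtain ⟨K, hK, -⟩ := exists_pairOf_eq hJ hL P (extendible_quotEndo hα _ _)
    exact ⟨K, hK⟩
  · simp only [mulL_one_sub_natEmb hJ hL]
    rfl
  · simp only [mulL_one_sub_natEmb hJ hL]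
    exact inter_range_stageHom hJ hL K n
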